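/- \textbf{Setting.} Let $n\in\{2,3\}$. A bounded connected open porous medium $Y\subset\mathbb R^n$, with $\partial Y=\partial_DY\cup\partial_NY$ (disjoint, $\partial_DY$ of positive measure), is decomposed into finitely many pairwise disjoint connected flat subdomains $\Omega_i$ of dimensions $d_i\in\{0,\dots,n\}$ (matrix components, fractures, intersections). Each one-sided contact of an $\Omega_i$ with an $\Omega_j$, $d_j=d_i+1$, is an interface $\Gamma_J$, coinciding with $\Omega_i$ and with unit normal $\nu$ pointing out of $\Omega_j$. Each $\Omega_i$ carries a symmetric positive definite tangential permeability tensor $K$, and each $\Gamma_J$ an aperture $\gamma>0$ and a normal permeability $K_\nu>0$; these are constant on each subdomain, respectively interface. The $\Omega_i$ and the $\Gamma_J$ are triangulated by simplices; meshes of different subdomains and the mortar meshes need not match. $V_h$ is the lowest-order Raviart--Thomas space on all subdomains, with zero normal flux on $\partial_NY$ and at fracture tips; $V_{0h}\subset V_h$ is the subspace with zero normal flux on the interfaces; $\Lambda_h$, $Q_h$ are the piecewise constants on the mortar meshes and on the subdomain meshes; $W_h=V_{0h}\times\Lambda_h$. The extension $R_h:\Lambda_h\to V_h$ is a linear map such that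 the normal component of $R_h\mu$ on the interfaces is the $L^2$-projection of $\mu$ to the normal traces of $V_h$, and $0$ on the remaining boundary. With $\llbracket\mu\rrbracket|_{\Omega_i}=-\sum_{J:\,\Gamma_J=\Omega_i}\mu|_{\Gamma_J}$ put, for $w=[u,\lambda]$, $r=[v,\mu]\in W_h$ and $p\in Q_h$, \begin{align*} a(w,r)&=(K^{-1}(u+R_h\lambda),v+R_h\mu)_\Omega+(\gamma K_\nu^{-1}\lambda,\mu)_\Gamma,\\ b(r,p)&=-(p,\nabla\cdot(v+R_h\mu)+\llbracket\mu\rrbracket)_\Omega,\\ a^D(w,r)&=\sum_T\sum_{f\subset\partial T}\bigl((u+R_h\lambda)\cdot\nu_f\bigr)\bigl((v+R_h\mu)\cdot\nu_f\bigr)(K^{-1}\phi_f,\phi_f)_T+(\gamma K_\nu^{-1}\lambda,\mu)_\Gamma, \end{align*} where $T$ runs over the elements of the subdomain meshes and $\phi_f$ is the Raviart--Thomas basis field of the face $f$ of $T$. Let $A,D_A:W_h\to W_h'$ and $B:W_h\to Q_h'$ be the operators of $a,a^D,b$; let $X=W_h\times Q_h$, $\|w\|_A^2=\langle Aw,w\rangle$,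 $\|w\|_{D_A}^2=\langle D_Aw,w\rangle$. For symmetric positive definite $H_w:W_h'\to W_h$ and $H_p:Q_h'\to Q_h$ let $$\mathcal A=\begin{pmatrix}A&B^T\\-B&0\end{pmatrix},\quad \mathcal M_D=\begin{pmatrix}H_w&0\\0&H_p\end{pmatrix},\quad \mathcal M_L=\begin{pmatrix}H_w^{-1}&0\\-B&H_p^{-1}\end{pmatrix}^{-1},$$ $(x,y)_{\mathcal M_D^{-1}}=\langle\mathcal M_D^{-1}x,y\rangle$ and $\|x\|_{\mathcal M_D^{-1}}^2=(x,x)_{\mathcal M_D^{-1}}$. \textbf{Theorem.} For every $\sigma$ there is $c_2>0$, and for every $\kappa$ there is $c_1>0$ (depending only on $n,\sigma$ and on $n,\sigma,\kappa$, respectively), such that the following holds for all geometries, meshes, parameters and extensions as above for which each element $T$ of the subdomain meshes contains a ball (of its affine hull) of some radius $r_T>0$ with $\operatorname{diam}T\le\sigma r_T$, and for which on each subdomain the ratio of the largest to the smallest eigenvalue of the tangential permeability is at most $\kappa$ ($\kappa=1$ for scalar permeabilities). First, $c_1\|r\|_{D_A}\le\|r\|_A\le c_2\|r\|_{D_A}$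 for all $r\in W_h$. Second, let $c_{1,w},c_{2,w},c_{1,p},c_{2,p}>0$ and $0\le\rho<1$, and let $H_w,H_p$ be symmetric positive definite with \begin{align*} c_{1,w}\langle f,H_wf\rangle&\le\langle f,A^{-1}f\rangle\le c_{2,w}\langle f,H_wf\rangle&&(f\in W_h'),\\ c_{1,p}\langle g,H_pg\rangle&\le\langle g,(BD_A^{-1}B^T)^{-1}g\rangle\le c_{2,p}\langle g,H_pg\rangle&&(g\in Q_h'), \end{align*} and $\|I-H_wA\|_A\le\rho$. Then $\mathcal M_L$ is FOV-equivalent to $\mathcal A$ in the $\mathcal M_D^{-1}$ inner product: for every $x\in X$, $x\ne0$, $$\xi_1\le\frac{(\mathcal M_L\mathcal Ax,x)_{\mathcal M_D^{-1}}}{(x,x)_{\mathcal M_D^{-1}}},\qquad \frac{\|\mathcal M_L\mathcal Ax\|_{\mathcal M_D^{-1}}}{\|x\|_{\mathcal M_D^{-1}}}\le\xi_2,$$ with the positive constants $$\xi_1=\tfrac{1-\rho}2\min\{c_{2,w}^{-1},\;c_{2,w}^{-1}c_2^{-2}c_{2,p}^{-1}\},\qquad \xi_2=\max\{2c_{1,w}^{-1},\;c_{1,p}^{-1}c_1^{-2}(1+c_{1,w}^{-1})\}.$$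 -/

import Mathlib

open MeasureTheory

namespace MixedDim

noncomputable section

/-! ### Inverses of linear maps and simplices -/

/-- The inverse of a bijective linear map; by convention `0` if the map is not bijective. -/
def linInv {E F : Type*} [AddCommGroup E] [Module ℝ E] [AddCommGroup F] [Module ℝ F]
    (L : E →ₗ[ℝ] F) : F →ₗ[ℝ] E :=
  open Classical in
  if h : Function.Bijective L then ((LinearEquiv.ofBijective L h).symm : F →ₗ[ℝ] E) else 0

/-- Points of the ambient Euclidean space. -/
abbrev Pt (n : ℕ) := EuclideanSpace ℝ (Fin n)

/-- Nondegenerate `d`-simplices in `ℝⁿ`. -/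
abbrev Simp (n d : ℕ) := Affine.Simplex ℝ (Pt n) d

section Simplices

variable {n d : ℕ}

/-- The relative interior of a simplex (the point itself if `d = 0`). -/
def relInt (T : Simp n d) : Set (Pt n) := T.setInterior (Set.Ioi 0)

/-- The relative interior of the face of `T` opposite to the vertex `k` (empty if `d = 0`). -/
def faceInt (T : Simp n d) (k : Fin (d + 1)) : Set (Pt n) :=
  {x | ∃ w : Fin (d + 1) → ℝ, w k = 0 ∧ (∀ l, l ≠ k → 0 < w l) ∧ ∑ l, w l = 1 ∧
    x = ∑ l, w l • T.points l}

/-- The distance from the vertex `k` to the hyperplane spanned by the opposite face. -/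
def height (T : Simp n d) (k : Fin (d + 1)) : ℝ :=
  Metric.infDist (T.points k) (affineSpan ℝ (T.points '' {k}ᶜ) : Set (Pt n))

/-- The lowest-order Raviart-Thomas basis field of the face opposite to the vertex `k`:
its outer normal component is `1` on that face and `0` on the other faces. -/
def rtBasis (T : Simp n d) (k : Fin (d + 1)) (x : Pt n) : Pt n :=
  (height T k)⁻¹ • (x - T.points k)

/-- The (tangential) divergence of `rtBasis T k`. -/
def rtDiv (T : Simp n d) (k : Fin (d + 1)) : ℝ := (d : ℝ) * (height T k)⁻¹

/-- Shape regularity: the diameter is at most `σ` times the radius of a ball of the affine hull of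
`T` that is contained in `T`. -/
def ShapeRegular (σ : ℝ) (T : Simp n d) : Prop :=
  ∃ c ∈ affineSpan ℝ (Set.range T.points), ∃ r : ℝ, 0 < r ∧
    Metric.closedBall c r ∩ (affineSpan ℝ (Set.range T.points) : Set (Pt n)) ⊆ T.closedInterior ∧
    Metric.diam T.closedInterior ≤ σ * r

theorem isCompact_closedInterior (T : Simp n d) : IsCompact T.closedInterior := by
  rw [← Affine.Simplex.convexHull_eq_closedInterior]
  exact (Set.finite_range _).isCompact_convexHull ℝ

theorem measure_closedInterior_lt_top (T : Simp n d) :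
    (μHE[d] : Measure (Pt n)) T.closedInterior < ⊤ := by
  set V := vectorSpan ℝ (Set.range T.points) with hV
  have hd : Module.finrank ℝ V = d := T.independent.finrank_vectorSpan (by simp)
  let f : V → Pt n := fun v => (v : Pt n) + T.points 0
  have hf : Isometry f := by
    refine Isometry.of_dist_eq fun a b => ?_
    simp [f, Subtype.dist_eq]
  have himg : f '' (f ⁻¹' T.closedInterior) = T.closedInterior := by
    rw [Set.image_preimage_eq_iff]
    intro x hx
    have hx' := T.closedInterior_subset_affineSpan hx
    have h0 : T.points 0 ∈ affineSpan ℝ (Set.range T.points) :=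
      subset_affineSpan ℝ _ (Set.mem_range_self 0)
    have := AffineSubspace.vsub_mem_direction hx' h0
    rw [direction_affineSpan] at this
    exact ⟨⟨_, this⟩, by simp [f]⟩
  have hc : IsCompact (f ⁻¹' T.closedInterior) :=
    hf.isClosedEmbedding.isCompact_preimage (isCompact_closedInterior T)
  have hvol : (μHE[d] : Measure V) = volume := by
    rw [← InnerProductSpace.euclideanHausdorffMeasure_eq_volume, hd]
  rw [← himg, hf.euclideanHausdorffMeasure_image, hvol]
  exact hc.measure_lt_top

theorem isFiniteMeasure_restrict (T : Simp n d) :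
    IsFiniteMeasure ((μHE[d] : Measure (Pt n)).restrict T.closedInterior) :=
  ⟨by simpa using measure_closedInterior_lt_top T⟩

theorem integrableOn_of_continuous (T : Simp n d) {f : Pt n → ℝ} (hf : Continuous f) :
    IntegrableOn f T.closedInterior (μHE[d] : Measure (Pt n)) := by
  have := isFiniteMeasure_restrict T
  exact hf.continuousOn.integrableOn_of_subset_isCompact (isCompact_closedInterior T)
    (isCompact_closedInterior T).measurableSet subset_rfl (measure_closedInterior_lt_top T).ne

end Simplices

/-! ### Mixed-dimensional geometry -/

/-- Moving from `x` a small distance against the direction `ν` one is in `D`. -/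
def ReachedFrom {n : ℕ} (D : Set (Pt n)) (ν x : Pt n) : Prop :=
  ∃ ε > 0, ∀ t ∈ Set.Ioo (0 : ℝ) ε, x - t • ν ∈ D

/-- A porous medium `Y ⊂ ℝⁿ` decomposed into finitely many pairwise disjoint flat subdomains
`Ω i` of dimension `dim i`: the components of the matrix (dimension `n`), the fractures
(dimension `n - 1`), and their intersections (lower dimensions). -/
structure Geometry (n : ℕ) where
  /-- the porous medium -/
  Y : Set (Pt n)
  isOpen_Y : IsOpen Y
  isConnected_Y : IsConnected Y
  isBounded_Y : Bornology.IsBounded Y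
  /-- the Dirichlet part of the outer boundary -/
  bdryD : Set (Pt n)
  /-- the Neumann part of the outer boundary -/
  bdryN : Set (Pt n)
  bdry_union : bdryD ∪ bdryN = frontier Y
  bdry_disjoint : Disjoint bdryD bdryN
  bdryD_pos : 0 < (μHE[n - 1] : Measure (Pt n)) bdryD
  /-- the index set of all subdomains, of all dimensions -/
  I : Type
  [finI : Fintype I]
  dim : I → ℕ
  dim_le : ∀ i, dim i ≤ n
  Ω : I → Set (Pt n)
  Ω_subset : ∀ i, Ω i ⊆ Y
  Ω_connected : ∀ i, IsConnected (Ω i)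
  Ω_dim : ∀ i, Module.finrank ℝ (vectorSpan ℝ (Ω i)) = dim i
  Ω_relOpen : ∀ i, ∃ U : Set (Pt n), IsOpen U ∧ Ω i = U ∩ (affineSpan ℝ (Ω i) : Set (Pt n))
  Ω_disjoint : Pairwise fun i j => Disjoint (Ω i) (Ω j)
  /-- the matrix components fill the medium -/
  matrix_cover : Y ⊆ ⋃ (i) (_ : dim i = n), closure (Ω i)
  /-- what is removed from the matrix is made of fractures (and their intersections) -/
  fracture_cover : Y \ (⋃ (i) (_ : dim i = n), Ω i) ⊆ ⋃ (i) (_ : dim i + 1 = n), closure (Ω i)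
  /-- every lower-dimensional subdomain bounds some subdomain of one dimension more -/
  hierarchy : ∀ i, dim i < n → ∃ j, dim j = dim i + 1 ∧ Ω i ⊆ closure (Ω j)
  /-- a subdomain that lies on one side of a lower-dimensional one somewhere does so everywhere -/
  side_uniform : ∀ i j ν, dim j = dim i + 1 → ν ∈ vectorSpan ℝ (Ω j) →
    (∀ v ∈ vectorSpan ℝ (Ω i), inner ℝ ν v = 0) →
    ∀ x ∈ Ω i, ReachedFrom (Ω j) ν x → ∀ y ∈ Ω i, ReachedFrom (Ω j) ν y

attribute [instance] Geometry.finI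

/-- An interface: it coincides with a subdomain `Ω low`, seen as a part of the boundary of a
subdomain `Ω high` of one dimension more; `normal` is the unit normal on it, tangential to
`Ω high` and pointing out of `Ω high`.  A subdomain that touches `Ω low` from two sides gives
two interfaces. -/
structure Interface {n : ℕ} (G : Geometry n) where
  low : G.I
  high : G.I
  normal : Pt n
  dim_high : G.dim high = G.dim low + 1
  norm_normal : ‖normal‖ = 1
  normal_mem : normal ∈ vectorSpan ℝ (G.Ω high)
  normal_orth : ∀ v ∈ vectorSpan ℝ (G.Ω low), inner ℝ normal v = 0
  reached : ∀ x ∈ G.Ω low, ReachedFrom (G.Ω high) normal x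

/-- The face of the simplex `T` (of a triangulation of `Ω i`) opposite to its vertex `k` lies on
the interface `J`. -/
def FaceOn {n : ℕ} {G : Geometry n} (i : G.I) (T : Simp n (G.dim i)) (k : Fin (G.dim i + 1))
    (J : Interface G) : Prop :=
  i = J.high ∧ faceInt T k ⊆ G.Ω J.low ∧
    ∀ l, l ≠ k → inner ℝ (T.points k - T.points l) J.normal < 0

/-- Triangulations of all subdomains and of all interfaces (mortar meshes).  The meshes of
different subdomains and the mortar meshes need not match. -/
structure Mesh {n : ℕ} (G : Geometry n) where
  /-- the elements of the subdomain meshes -/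
  E : Type
  [finE : Fintype E]
  /-- the subdomain to which an element belongs -/
  sub : E → G.I
  T : ∀ e, Simp n (G.dim (sub e))
  T_subset : ∀ e, relInt (T e) ⊆ G.Ω (sub e)
  T_cover : ∀ i, closure (G.Ω i) = ⋃ (e) (_ : sub e = i), (T e).closedInterior
  T_disjoint : ∀ e e', e ≠ e' → sub e = sub e' → Disjoint (relInt (T e)) (relInt (T e'))
  /-- inside the subdomain two elements meet in a common face -/
  T_conforming : ∀ e e', e ≠ e' → sub e = sub e' →
    (T e).closedInterior ∩ (T e').closedInterior ∩ G.Ω (sub e) ⊆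
      convexHull ℝ (Set.range (T e).points ∩ Set.range (T e').points)
  /-- each face is inside the subdomain, or on an interface, or on the Dirichlet part or the
  Neumann part of the outer boundary, or on a fracture tip -/
  face_resolved : ∀ e k, faceInt (T e) k ⊆ G.Ω (sub e) ∨ (∃ J, FaceOn (sub e) (T e) k J) ∨
    faceInt (T e) k ⊆ G.bdryD ∨ faceInt (T e) k ⊆ G.bdryN ∨
    faceInt (T e) k ⊆ G.Y \ (G.Ω (sub e) ∪ ⋃ (i) (_ : G.dim i + 1 = G.dim (sub e)), G.Ω i)
  /-- the elements of the mortar meshes -/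
  M : Type
  [finM : Fintype M]
  /-- the interface to which a mortar element belongs -/
  ifc : M → Interface G
  S : ∀ m, Simp n (G.dim (ifc m).low)
  S_subset : ∀ m, relInt (S m) ⊆ G.Ω (ifc m).low
  S_cover : ∀ J : Interface G, closure (G.Ω J.low) = ⋃ (m) (_ : ifc m = J), (S m).closedInterior
  S_disjoint : ∀ m m', m ≠ m' → ifc m = ifc m' → Disjoint (relInt (S m)) (relInt (S m'))
  S_conforming : ∀ m m', m ≠ m' → ifc m = ifc m' →
    (S m).closedInterior ∩ (S m').closedInterior ∩ G.Ω (ifc m).low ⊆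
      convexHull ℝ (Set.range (S m).points ∩ Set.range (S m').points)

attribute [instance] Mesh.finE Mesh.finM

/-- The physical parameters: the permeability tensor `K i` of each subdomain (only its action on
the tangent space of `Ω i` matters), and the distance `γ` (aperture) and the normal permeability
`Kν` of each interface. -/
structure Params {n : ℕ} (G : Geometry n) where
  K : G.I → (Pt n →ₗ[ℝ] Pt n)
  K_symm : ∀ i x y, inner ℝ (K i x) y = inner ℝ x (K i y)
  K_pos : ∀ i x, x ≠ 0 → 0 < inner ℝ (K i x) x
  K_tangential : ∀ i, ∀ x ∈ vectorSpan ℝ (G.Ω i), K i x ∈ vectorSpan ℝ (G.Ω i)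
  γ : Interface G → ℝ
  γ_pos : ∀ J, 0 < γ J
  Kν : Interface G → ℝ
  Kν_pos : ∀ J, 0 < Kν J

/-- On each subdomain the ratio of the largest to the smallest tangential permeability is at most
`κ`.  For scalar permeabilities `κ = 1` is allowed. -/
def Params.AnisotropyLE {n : ℕ} {G : Geometry n} (P : Params G) (κ : ℝ) : Prop :=
  ∀ i, ∃ m > 0, ∀ x ∈ vectorSpan ℝ (G.Ω i),
    m * ‖x‖ ^ 2 ≤ inner ℝ (P.K i x) x ∧ inner ℝ (P.K i x) x ≤ κ * m * ‖x‖ ^ 2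

/-! ### Discrete spaces -/

namespace Mesh

variable {n : ℕ} {G : Geometry n} (𝓣 : Mesh G)

/-- Pairs of an element and one of its faces (named by the opposite vertex). -/
abbrev Face := Σ e : 𝓣.E, Fin (G.dim (𝓣.sub e) + 1)

/-- The relative interior of a face. -/
def fInt (f : 𝓣.Face) : Set (Pt n) := faceInt (𝓣.T f.1) f.2

/-- The face lies on the interface `J` and is seen from the side of `J`. -/
def On (f : 𝓣.Face) (J : Interface G) : Prop := FaceOn (𝓣.sub f.1) (𝓣.T f.1) f.2 J

/-- The face lies inside its subdomain. -/
def IsInner (f : 𝓣.Face) : Prop := 𝓣.fInt f ⊆ G.Ω (𝓣.sub f.1)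

/-- The lowest-order Raviart-Thomas flux space on all subdomains of positive dimension.  A
piecewise Raviart-Thomas field is given by its outer normal components on the faces of the
elements.  These add up to zero on two sides of an inner face (normal continuity), and they
vanish on the Neumann boundary and at fracture tips. -/
def V : Submodule ℝ (𝓣.Face → ℝ) where
  carrier := {α |
    (∀ f, G.dim (𝓣.sub f.1) = 0 → α f = 0) ∧
    (∀ f f', f ≠ f' → 𝓣.sub f.1 = 𝓣.sub f'.1 → 𝓣.fInt f = 𝓣.fInt f' → 𝓣.IsInner f →
      α f + α f' = 0) ∧
    (∀ f, ¬ 𝓣.IsInner f → (¬ ∃ J, 𝓣.On f J) → ¬ 𝓣.fInt f ⊆ G.bdryD → α f = 0)}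
  add_mem' := by
    rintro α β ⟨h1, h2, h3⟩ ⟨k1, k2, k3⟩
    refine ⟨fun f h => ?_, fun f f' a b c d => ?_, fun f a b c => ?_⟩
    · simp [h1 f h, k1 f h]
    · have := h2 f f' a b c d
      have := k2 f f' a b c d
      simp only [Pi.add_apply]
      linarith
    · simp [h3 f a b c, k3 f a b c]
  zero_mem' := by simp
  smul_mem' := by
    rintro r α ⟨h1, h2, h3⟩
    refine ⟨fun f h => ?_, fun f f' a b c d => ?_, fun f a b c => ?_⟩
    · simp [h1 f h]
    · have := h2 f f' a b c d
      simp only [Pi.smul_apply, smul_eq_mul]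
      rw [← mul_add, this, mul_zero]
    · simp [h3 f a b c]

/-- The fluxes with zero normal component on all interfaces. -/
def V₀ : Submodule ℝ (𝓣.Face → ℝ) where
  carrier := {α | α ∈ 𝓣.V ∧ ∀ f J, 𝓣.On f J → α f = 0}
  add_mem' := by
    rintro α β ⟨h1, h2⟩ ⟨k1, k2⟩
    exact ⟨add_mem h1 k1, fun f J h => by simp [h2 f J h, k2 f J h]⟩
  zero_mem' := ⟨zero_mem _, by simp⟩
  smul_mem' := by
    rintro r α ⟨h1, h2⟩
    exact ⟨𝓣.V.smul_mem r h1, fun f J h => by simp [h2 f J h]⟩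

/-- Piecewise constant mortar functions. -/
abbrev Λ := 𝓣.M → ℝ

/-- Piecewise constant pressures. -/
abbrev Q := 𝓣.E → ℝ

/-- The flux space `V₀ × Λ`. -/
abbrev W := 𝓣.V₀ × 𝓣.Λ

/-- The value on the element `e` of the piecewise Raviart-Thomas field with normal components
`α`. -/
def field (α : 𝓣.Face → ℝ) (e : 𝓣.E) (x : Pt n) : Pt n :=
  ∑ k, α ⟨e, k⟩ • rtBasis (𝓣.T e) k x

/-- The divergence on the element `e` of the field with normal components `α`. -/
def divg (α : 𝓣.Face → ℝ) (e : 𝓣.E) : ℝ := ∑ k, α ⟨e, k⟩ * rtDiv (𝓣.T e) k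

open Classical in
/-- The mortar function `μ` on the interface `J`. -/
def mortar (μ : 𝓣.Λ) (J : Interface G) (x : Pt n) : ℝ :=
  ∑ m with 𝓣.ifc m = J, (𝓣.S m).closedInterior.indicator (fun _ => μ m) x

open Classical in
/-- The jump of a mortar function on the subdomain `Ω i`: minus the sum of its values on all
interfaces that coincide with `Ω i`. -/
def jump (μ : 𝓣.Λ) (i : G.I) (x : Pt n) : ℝ :=
  -∑ m with (𝓣.ifc m).low = i, (𝓣.S m).closedInterior.indicator (fun _ => μ m) x

open Classical in
/-- `R` is a discrete extension operator: the normal component of `R μ` is the `L²` projection of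
`μ` to the normal traces of `V` on the interfaces, and zero on the remaining boundary. -/
def IsExtension (R : 𝓣.Λ →ₗ[ℝ] 𝓣.V) : Prop :=
  (∀ (μ : 𝓣.Λ) (J : Interface G) (v : 𝓣.V),
    ∑ f with 𝓣.On f J, ∫ x in 𝓣.fInt f,
      ((R μ : 𝓣.Face → ℝ) f - 𝓣.mortar μ J x) * (v : 𝓣.Face → ℝ) f ∂(μHE[G.dim J.low]) = 0) ∧
  ∀ (μ : 𝓣.Λ) (f : 𝓣.Face), ¬ 𝓣.IsInner f → (¬ ∃ J, 𝓣.On f J) → (R μ : 𝓣.Face → ℝ) f = 0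

theorem field_add (α β : 𝓣.Face → ℝ) (e : 𝓣.E) (x : Pt n) :
    𝓣.field (α + β) e x = 𝓣.field α e x + 𝓣.field β e x := by
  simp [field, add_smul, Finset.sum_add_distrib]

theorem field_smul (c : ℝ) (α : 𝓣.Face → ℝ) (e : 𝓣.E) (x : Pt n) :
    𝓣.field (c • α) e x = c • 𝓣.field α e x := by
  simp [field, mul_smul, Finset.smul_sum]

theorem continuous_field (α : 𝓣.Face → ℝ) (e : 𝓣.E) : Continuous (𝓣.field α e) := by
  unfold field rtBasis
  fun_prop

theorem divg_add (α β : 𝓣.Face → ℝ) (e : 𝓣.E) :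
    𝓣.divg (α + β) e = 𝓣.divg α e + 𝓣.divg β e := by
  simp [divg, add_mul, Finset.sum_add_distrib]

theorem divg_smul (c : ℝ) (α : 𝓣.Face → ℝ) (e : 𝓣.E) :
    𝓣.divg (c • α) e = c * 𝓣.divg α e := by
  simp [divg, mul_assoc, Finset.mul_sum]

theorem jump_add (μ ν : 𝓣.Λ) (i : G.I) (x : Pt n) :
    𝓣.jump (μ + ν) i x = 𝓣.jump μ i x + 𝓣.jump ν i x := by
  classical
  simp only [jump, Set.indicator_apply, Pi.add_apply]
  rw [← neg_add, ← Finset.sum_add_distrib]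
  congr 1
  refine Finset.sum_congr rfl fun m _ => ?_
  split_ifs <;> simp

theorem jump_smul (c : ℝ) (μ : 𝓣.Λ) (i : G.I) (x : Pt n) :
    𝓣.jump (c • μ) i x = c * 𝓣.jump μ i x := by
  classical
  simp only [jump, Set.indicator_apply, Pi.smul_apply, smul_eq_mul]
  rw [mul_neg, Finset.mul_sum]
  congr 1
  refine Finset.sum_congr rfl fun m _ => ?_
  split_ifs <;> simp

theorem integrableOn_jump (μ : 𝓣.Λ) (i : G.I) (e : 𝓣.E) :
    IntegrableOn (𝓣.jump μ i) (𝓣.T e).closedInterior (μHE[G.dim (𝓣.sub e)]) := by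
  have := isFiniteMeasure_restrict (𝓣.T e)
  unfold jump
  refine (integrable_finsetSum _ fun m _ => ?_).neg
  exact (integrable_const _).indicator (isCompact_closedInterior _).measurableSet

end Mesh

/-! ### The discrete problem -/

/-- The discrete mixed-dimensional problem: geometry, meshes, physical parameters and a discrete
extension operator. -/
structure Problem (n : ℕ) where
  G : Geometry n
  𝓣 : Mesh G
  P : Params G
  R : 𝓣.Λ →ₗ[ℝ] 𝓣.V
  isExtension_R : 𝓣.IsExtension R

namespace Problem

variable {n : ℕ} (D : Problem n)

abbrev W := D.𝓣.W
abbrev Q := D.𝓣.Q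
/-- The dual space of the flux space. -/
abbrev W' := Module.Dual ℝ D.W
/-- The dual space of the pressure space. -/
abbrev Q' := Module.Dual ℝ D.Q

/-- The normal components of the total flux `v + R μ`. -/
def tot : D.W →ₗ[ℝ] (D.𝓣.Face → ℝ) :=
  D.𝓣.V₀.subtype.coprod (D.𝓣.V.subtype ∘ₗ D.R)

/-- The inverse permeability tensor. -/
def Kinv (i : D.G.I) : Pt n →ₗ[ℝ] Pt n := linInv (D.P.K i)

/-- The interface term `(γ Kν⁻¹ λ, μ)_Γ`. -/
def cForm (l μ : D.𝓣.Λ) : ℝ :=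
  ∑ m, ∫ _ in (D.𝓣.S m).closedInterior,
    D.P.γ (D.𝓣.ifc m) * (D.P.Kν (D.𝓣.ifc m))⁻¹ * l m * μ m ∂(μHE[D.G.dim (D.𝓣.ifc m).low])

/-- The bilinear form `a`. -/
def aForm (w r : D.W) : ℝ :=
  ∑ e, ∫ x in (D.𝓣.T e).closedInterior,
    inner ℝ (D.Kinv (D.𝓣.sub e) (D.𝓣.field (D.tot w) e x)) (D.𝓣.field (D.tot r) e x)
      ∂(μHE[D.G.dim (D.𝓣.sub e)])
  + D.cForm w.2 r.2

/-- The bilinear form `aᴰ`: on each element only the diagonal of the local mass matrix is kept. -/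
def aDForm (w r : D.W) : ℝ :=
  ∑ e, ∑ k, D.tot w ⟨e, k⟩ * D.tot r ⟨e, k⟩ *
    ∫ x in (D.𝓣.T e).closedInterior,
      inner ℝ (D.Kinv (D.𝓣.sub e) (rtBasis (D.𝓣.T e) k x)) (rtBasis (D.𝓣.T e) k x)
        ∂(μHE[D.G.dim (D.𝓣.sub e)])
  + D.cForm w.2 r.2

/-- The bilinear form `b(r, p) = -(p, div (v + R μ) + ⟦μ⟧)_Ω`. -/
def bForm (r : D.W) (p : D.Q) : ℝ :=
  -∑ e, ∫ x in (D.𝓣.T e).closedInterior,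
    p e * (D.𝓣.divg (D.tot r) e + D.𝓣.jump r.2 (D.𝓣.sub e) x) ∂(μHE[D.G.dim (D.𝓣.sub e)])

theorem cForm_add_left (l l' μ : D.𝓣.Λ) :
    D.cForm (l + l') μ = D.cForm l μ + D.cForm l' μ := by
  simp only [cForm, integral_const, smul_eq_mul, Pi.add_apply, ← Finset.sum_add_distrib]
  exact Finset.sum_congr rfl fun m _ => by ring

theorem cForm_smul_left (c : ℝ) (l μ : D.𝓣.Λ) : D.cForm (c • l) μ = c * D.cForm l μ := by
  simp only [cForm, integral_const, smul_eq_mul, Pi.smul_apply, Finset.mul_sum]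
  exact Finset.sum_congr rfl fun m _ => by ring

theorem cForm_comm (l μ : D.𝓣.Λ) : D.cForm l μ = D.cForm μ l := by
  simp only [cForm, integral_const, smul_eq_mul]
  exact Finset.sum_congr rfl fun m _ => by ring

theorem Kinv_symm (i : D.G.I) (x y : Pt n) : inner ℝ (D.Kinv i x) y = inner ℝ x (D.Kinv i y) := by
  have hinj : Function.Injective (D.P.K i) := by
    rw [injective_iff_map_eq_zero]
    intro x hx
    by_contra h
    have := D.P.K_pos i x h
    simp [hx] at this
  have hb : Function.Bijective (D.P.K i) :=
    ⟨hinj, LinearMap.surjective_of_injective hinj⟩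
  obtain ⟨u, rfl⟩ := hb.2 x
  obtain ⟨v, rfl⟩ := hb.2 y
  have key : ∀ u, D.Kinv i (D.P.K i u) = u := by
    intro u
    simp only [Kinv, linInv, hb, dif_pos]
    exact (LinearEquiv.ofBijective (D.P.K i) hb).symm_apply_apply u
  rw [key, key, D.P.K_symm]

theorem integrable_aForm (α β : D.𝓣.Face → ℝ) (e : D.𝓣.E) :
    IntegrableOn (fun x => inner ℝ (D.Kinv (D.𝓣.sub e) (D.𝓣.field α e x)) (D.𝓣.field β e x))
      (D.𝓣.T e).closedInterior (μHE[D.G.dim (D.𝓣.sub e)]) := by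
  refine integrableOn_of_continuous _ ?_
  have h1 := D.𝓣.continuous_field α e
  have h2 := D.𝓣.continuous_field β e
  have h3 : Continuous (D.Kinv (D.𝓣.sub e)) := LinearMap.continuous_of_finiteDimensional _
  exact (h3.comp h1).inner h2

theorem aForm_comm (w r : D.W) : D.aForm w r = D.aForm r w := by
  unfold aForm
  rw [D.cForm_comm]
  congr 1
  refine Finset.sum_congr rfl fun e _ => ?_
  congr 1
  funext x
  rw [D.Kinv_symm, real_inner_comm]

theorem aForm_add_left (w w' r : D.W) : D.aForm (w + w') r = D.aForm w r + D.aForm w' r := by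
  unfold aForm
  rw [Prod.snd_add, D.cForm_add_left, add_add_add_comm, ← Finset.sum_add_distrib]
  congr 1
  refine Finset.sum_congr rfl fun e _ => ?_
  rw [← integral_add (D.integrable_aForm _ _ e) (D.integrable_aForm _ _ e)]
  congr 1
  funext x
  rw [map_add, D.𝓣.field_add, map_add, inner_add_left]

theorem aForm_smul_left (c : ℝ) (w r : D.W) : D.aForm (c • w) r = c * D.aForm w r := by
  unfold aForm
  rw [Prod.smul_snd, D.cForm_smul_left, mul_add, Finset.mul_sum]
  congr 1
  refine Finset.sum_congr rfl fun e _ => ?_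
  rw [← integral_const_mul]
  congr 1
  funext x
  rw [map_smul, D.𝓣.field_smul, map_smul, real_inner_smul_left]

theorem aDForm_comm (w r : D.W) : D.aDForm w r = D.aDForm r w := by
  unfold aDForm
  rw [D.cForm_comm]
  congr 1
  refine Finset.sum_congr rfl fun e _ => Finset.sum_congr rfl fun k _ => ?_
  ring

theorem aDForm_add_left (w w' r : D.W) : D.aDForm (w + w') r = D.aDForm w r + D.aDForm w' r := by
  unfold aDForm
  rw [Prod.snd_add, D.cForm_add_left, add_add_add_comm, ← Finset.sum_add_distrib]
  congr 1
  refine Finset.sum_congr rfl fun e _ => ?_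
  rw [← Finset.sum_add_distrib]
  refine Finset.sum_congr rfl fun k _ => ?_
  rw [map_add, Pi.add_apply]
  ring

theorem aDForm_smul_left (c : ℝ) (w r : D.W) : D.aDForm (c • w) r = c * D.aDForm w r := by
  unfold aDForm
  rw [Prod.smul_snd, D.cForm_smul_left, mul_add, Finset.mul_sum]
  congr 1
  refine Finset.sum_congr rfl fun e _ => ?_
  rw [Finset.mul_sum]
  refine Finset.sum_congr rfl fun k _ => ?_
  rw [map_smul, Pi.smul_apply, smul_eq_mul]
  ring

theorem integrable_bForm (r : D.W) (p : D.Q) (e : D.𝓣.E) :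
    IntegrableOn (fun x => p e * (D.𝓣.divg (D.tot r) e + D.𝓣.jump r.2 (D.𝓣.sub e) x))
      (D.𝓣.T e).closedInterior (μHE[D.G.dim (D.𝓣.sub e)]) := by
  have := isFiniteMeasure_restrict (D.𝓣.T e)
  exact ((integrable_const _).add (D.𝓣.integrableOn_jump _ _ e)).const_mul _

/-- The operator `A : W → W'` of the form `a`. -/
def A : D.W →ₗ[ℝ] D.W' :=
  LinearMap.mk₂ ℝ D.aForm D.aForm_add_left D.aForm_smul_left
    (fun w r r' => by rw [D.aForm_comm, D.aForm_add_left, D.aForm_comm r, D.aForm_comm r'])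
    (fun c w r => by rw [D.aForm_comm, D.aForm_smul_left, D.aForm_comm r, smul_eq_mul])

/-- The operator `D_A : W → W'` of the form `aᴰ`. -/
def DA : D.W →ₗ[ℝ] D.W' :=
  LinearMap.mk₂ ℝ D.aDForm D.aDForm_add_left D.aDForm_smul_left
    (fun w r r' => by rw [D.aDForm_comm, D.aDForm_add_left, D.aDForm_comm r, D.aDForm_comm r'])
    (fun c w r => by rw [D.aDForm_comm, D.aDForm_smul_left, D.aDForm_comm r, smul_eq_mul])

/-- The operator `B : W → Q'` of the form `b`. -/
def B : D.W →ₗ[ℝ] D.Q' :=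
  LinearMap.mk₂ ℝ D.bForm
    (fun r r' p => by
      unfold bForm
      rw [← neg_add, ← Finset.sum_add_distrib]
      congr 1
      refine Finset.sum_congr rfl fun e _ => ?_
      rw [← integral_add (D.integrable_bForm _ _ e) (D.integrable_bForm _ _ e)]
      congr 1
      funext x
      rw [map_add, D.𝓣.divg_add, Prod.snd_add, D.𝓣.jump_add]
      ring)
    (fun c r p => by
      unfold bForm
      rw [smul_neg, Finset.smul_sum]
      congr 1
      refine Finset.sum_congr rfl fun e _ => ?_
      rw [smul_eq_mul, ← integral_const_mul]
      congr 1
      funext x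
      rw [map_smul, D.𝓣.divg_smul, Prod.smul_snd, D.𝓣.jump_smul]
      ring)
    (fun r p p' => by
      unfold bForm
      rw [← neg_add, ← Finset.sum_add_distrib]
      congr 1
      refine Finset.sum_congr rfl fun e _ => ?_
      rw [← integral_add (D.integrable_bForm _ _ e) (D.integrable_bForm _ _ e)]
      congr 1
      funext x
      rw [Pi.add_apply]
      ring)
    (fun c r p => by
      unfold bForm
      rw [smul_neg, Finset.smul_sum]
      congr 1
      refine Finset.sum_congr rfl fun e _ => ?_
      rw [smul_eq_mul, ← integral_const_mul]
      congr 1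
      funext x
      rw [Pi.smul_apply, smul_eq_mul]
      ring)

/-- The transpose `Bᵀ : Q → W'`. -/
def BT : D.Q →ₗ[ℝ] D.W' := D.B.flip

/-- The operator `B D_A⁻¹ Bᵀ : Q → Q'`. -/
def Schur : D.Q →ₗ[ℝ] D.Q' := D.B ∘ₗ linInv D.DA ∘ₗ D.BT

/-- The space `X = W × Q`. -/
abbrev X := D.W × D.Q

/-- The dual `X' = W' × Q'`. -/
abbrev X' := D.W' × D.Q'

/-- The duality pairing of `X'` and `X`. -/
def pair (f : D.X') (x : D.X) : ℝ := f.1 x.1 + f.2 x.2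

/-- The coefficient operator `𝒜 = [[A, Bᵀ], [-B, 0]]`. -/
def calA : D.X →ₗ[ℝ] D.X' := (D.A.coprod D.BT).prod ((-D.B).coprod 0)

/-- The block diagonal preconditioner `[[Hw, 0], [0, Hp]]`. -/
def MD (Hw : D.W' →ₗ[ℝ] D.W) (Hp : D.Q' →ₗ[ℝ] D.Q) : D.X' →ₗ[ℝ] D.X :=
  (Hw.coprod 0).prod (LinearMap.coprod 0 Hp)

/-- The block lower triangular preconditioner `[[Hw⁻¹, 0], [-B, Hp⁻¹]]⁻¹`. -/
def ML (Hw : D.W' →ₗ[ℝ] D.W) (Hp : D.Q' →ₗ[ℝ] D.Q) : D.X' →ₗ[ℝ] D.X :=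
  linInv (((linInv Hw).coprod 0).prod ((-D.B).coprod (linInv Hp)))

/-- The inner product `(x, y) = ⟨M⁻¹ x, y⟩` on `X`. -/
def ip (M : D.X' →ₗ[ℝ] D.X) (x y : D.X) : ℝ := D.pair (linInv M x) y

/-- The norm of the inner product `ip M`. -/
def ipNorm (M : D.X' →ₗ[ℝ] D.X) (x : D.X) : ℝ := Real.sqrt (D.ip M x x)

/-- The norm `‖w‖_A = ‖w‖_a`. -/
def normA (w : D.W) : ℝ := Real.sqrt (D.A w w)

/-- The norm `‖w‖_{D_A} = ‖w‖_{aᴰ}`. -/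
def normDA (w : D.W) : ℝ := Real.sqrt (D.DA w w)

end Problem

/-- `H : E' → E` is symmetric positive definite. -/
def IsSPD {E : Type*} [AddCommGroup E] [Module ℝ E] (H : Module.Dual ℝ E →ₗ[ℝ] E) : Prop :=
  (∀ f g : Module.Dual ℝ E, f (H g) = g (H f)) ∧ ∀ f : Module.Dual ℝ E, f ≠ 0 → 0 < f (H f)

/-- `c₁ (H f, f) ≤ (S f, f) ≤ c₂ (H f, f)` for all `f ∈ E'`. -/
def SpectrallyEquiv {E : Type*} [AddCommGroup E] [Module ℝ E]
    (c₁ c₂ : ℝ) (H S : Module.Dual ℝ E →ₗ[ℝ] E) : Prop :=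
  ∀ f : Module.Dual ℝ E, c₁ * f (H f) ≤ f (S f) ∧ f (S f) ≤ c₂ * f (H f)

end

end MixedDim

namespace MixedDim

/-! ### Inverse forms and field-of-values bounds -/

section Abstract

variable {E F : Type*} [AddCommGroup E] [Module ℝ E] [AddCommGroup F] [Module ℝ F]

/-! The norm equivalence is local: the interface term is common to both forms, so only the mass
matrix of one simplex has to be compared with its diagonal. The upper bound is `2⟨Lx, y⟩ ≤ ⟨Lx, x⟩ +
⟨Ly, y⟩` for the at most `n + 1` basis fields of an element, which gives `c₂² = n + 1`
(`integral_form_le`). For the lower bound, let `h_j` be the heights, `β_j = α_j / h_j` and `s = ∑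
β_j`. A field with normal components `α` equals `∑ (s w_l - β_l) p_l` at the point with barycentric
coordinates `w`, so its norm is at least `|s w_k - β_k| h_k`. On a copy of the simplex shrunk by
`1/4` into a suitable corner this is at least `|α_k| / 2` (`sq_le_of_mem_corner`), while shape
regularity bounds the basis fields by `|σ|`. Hence the constant does not depend on the element, and
the permeability enters only through its anisotropy `κ` (`sum_integral_form_le`).

The field-of-values bounds are linear algebra (`fov_bounds`). With `z = A⁻¹ Bᵀ p`, the numerator for
`x = (w, p)` is `a(w, w) + h(z, w) + h(z, z)`, where `h(u, v) = ⟨A u, Hw A v⟩`. Since `h(w + z, w +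
z) ≥ 0` and `h(w, w) ≤ (1 + ρ) a(w, w)`, it is at least `(1 - ρ)/2 · (a(w, w) + h(z, z))`. The norm
bound is a weighted Cauchy-Schwarz inequality whose weights are the row and column sums of `[[1, 1],
[1, c₁w⁻¹]]`. The hypotheses on `Hw` and `Hp` concern inverses; `apply_le_of_form_le` turns them
into inequalities between the operators themselves, and the norm equivalence replaces `B A⁻¹ Bᵀ` by
`B D_A⁻¹ Bᵀ`. -/

theorem linInv_apply_apply {L : E →ₗ[ℝ] F} (hL : Function.Bijective L) (x : E) :
    linInv L (L x) = x := by
  simp only [linInv, hL, dif_pos]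
  exact (LinearEquiv.ofBijective L hL).symm_apply_apply x

theorem apply_linInv_apply {L : E →ₗ[ℝ] F} (hL : Function.Bijective L) (y : F) :
    L (linInv L y) = y := by
  simp only [linInv, hL, dif_pos]
  exact (LinearEquiv.ofBijective L hL).apply_symm_apply y

theorem linInv_eq_of_apply_eq {L : E →ₗ[ℝ] F} (hL : Function.Bijective L) {x : E} {y : F}
    (h : L x = y) : linInv L y = x := by
  rw [← h, linInv_apply_apply hL]

theorem linInv_of_not_bijective {L : E →ₗ[ℝ] F} (hL : ¬ Function.Bijective L) :
    linInv L = 0 := by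
  simp [linInv, hL]

/-- Inverting symmetric nonnegative operators reverses the order of their forms. -/
theorem apply_le_of_form_le (b : E →ₗ[ℝ] F →ₗ[ℝ] ℝ) (H : E →ₗ[ℝ] F)
    (hsymm : ∀ f g, b f (H g) = b g (H f)) (hnonneg : ∀ f, 0 ≤ b f (H f)) {C : ℝ} (hC : 0 < C)
    {f g : E} {y : F} (hg : H g = y) (hle : b f (H f) ≤ C * b f y) : b f y ≤ C * b g y := by
  -- The form at `f - C • g` is `b f (H f) - 2C b f y + C² b g y`; the assumption bounds its first
  -- term by `C b f y`, and one factor `C` cancels. The general pairing `b` allows `H` to map a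
  -- space to its dual or a dual to its space.
  have h := hnonneg (f - C • g)
  have h1 : b g (H f) = b f y := by rw [← hsymm, hg]
  simp only [map_sub, map_smul, LinearMap.sub_apply, LinearMap.smul_apply, smul_eq_mul, hg,
    h1] at h
  have : 0 ≤ C * (C * b g y - b f y) := by linarith
  have := nonneg_of_mul_nonneg_right this hC
  linarith

theorem form_sq_le (a : E →ₗ[ℝ] E →ₗ[ℝ] ℝ) (hs : ∀ x y, a x y = a y x) (hn : ∀ x, 0 ≤ a x x)
    (x y : E) : a x y ^ 2 ≤ a x x * a y y :=
  LinearMap.BilinForm.apply_sq_le_of_symm a hn ⟨fun x y => by simpa using hs x y⟩ x y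

theorem abs_form_le (a : E →ₗ[ℝ] E →ₗ[ℝ] ℝ) (hs : ∀ x y, a x y = a y x) (hn : ∀ x, 0 ≤ a x x)
    (x y : E) : |a x y| ≤ √(a x x) * √(a y y) := by
  rw [← Real.sqrt_mul (hn x)]
  exact Real.abs_le_sqrt (form_sq_le a hs hn x y)

theorem bijective_of_form_pos [FiniteDimensional ℝ E] {a : E →ₗ[ℝ] Module.Dual ℝ E}
    (h : ∀ x, x ≠ 0 → 0 < a x x) : Function.Bijective a := by
  have hinj : Function.Injective a := by
    rw [injective_iff_map_eq_zero]
    intro x hx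
    by_contra h0
    have := h x h0
    simp [hx] at this
  exact ⟨hinj, (LinearMap.injective_iff_surjective_of_finrank_eq_finrank
    Subspace.dual_finrank_eq.symm).1 hinj⟩

theorem IsSPD.bijective [FiniteDimensional ℝ E] {H : Module.Dual ℝ E →ₗ[ℝ] E} (h : IsSPD H) :
    Function.Bijective H := by
  have hinj : Function.Injective H := by
    rw [injective_iff_map_eq_zero]
    intro f hf
    by_contra h0
    have := h.2 f h0
    simp [hf] at this
  exact ⟨hinj, (LinearMap.injective_iff_surjective_of_finrank_eq_finrank
    Subspace.dual_finrank_eq).1 hinj⟩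

theorem IsSPD.nonneg {H : Module.Dual ℝ E →ₗ[ℝ] E} (h : IsSPD H) (f : Module.Dual ℝ E) :
    0 ≤ f (H f) := by
  rcases eq_or_ne f 0 with rfl | h0
  · simp
  · exact (h.2 f h0).le

/-- An operator whose inverse is spectrally equivalent to a symmetric positive definite one is
bijective. -/
theorem SpectrallyEquiv.bijective [FiniteDimensional ℝ E] {H : Module.Dual ℝ E →ₗ[ℝ] E}
    {S : E →ₗ[ℝ] Module.Dual ℝ E} {c C : ℝ} (hc : 0 < c) (hH : IsSPD H)
    (h : SpectrallyEquiv c C H (linInv S)) : Function.Bijective S := by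
  by_contra hS
  -- By convention the inverse of a non-bijective `S` is `0`, so the positive lower bound leaves
  -- only the zero space, on which every map is bijective. Thus solvability of the systems with `A`
  -- and the Schur complement is contained in the spectral hypotheses.
  have h0 : ∀ f : Module.Dual ℝ E, f = 0 := by
    intro f
    by_contra hf
    have h1 := (h f).1
    have h2 := mul_pos hc (hH.2 f hf)
    rw [linInv_of_not_bijective hS] at h1
    simp at h1
    linarith
  have hE : ∀ x : E, x = 0 := fun x => (Module.forall_dual_apply_eq_zero_iff ℝ x).1
    fun f => by simp [h0 f]
  exact hS ⟨fun x y _ => by rw [hE x, hE y], fun f => ⟨0, by rw [h0 f, map_zero]⟩⟩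

/-- The lower bound for `S⁻¹` against `H` is reversed by inversion: since `f = H⁻¹ x`, it bounds the
form of `S` by that of `H⁻¹`. Here `apply_le_of_form_le` compares the functionals `S x` and `f`. -/
theorem le_of_spectrallyEquiv_left {H : Module.Dual ℝ E →ₗ[ℝ] E} {S : E →ₗ[ℝ] Module.Dual ℝ E}
    {c C : ℝ} (hc : 0 < c) (hH : IsSPD H) (hS : Function.Bijective S)
    (h : SpectrallyEquiv c C H (linInv S)) {x : E} {f : Module.Dual ℝ E} (hf : H f = x) :
    S x x ≤ c⁻¹ * f x := by
  refine apply_le_of_form_le (E := Module.Dual ℝ E) (F := E) LinearMap.id H hH.1 hH.nonneg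
    (inv_pos.2 hc) hf ?_
  have := (h (S x)).1
  rw [linInv_apply_apply hS] at this
  rw [le_inv_mul_iff₀ hc]
  exact this

/-- The converse comparison, with the roles of `H` and `S⁻¹` exchanged; hence `S⁻¹` must now be
symmetric and nonnegative. -/
theorem le_of_spectrallyEquiv_right {H : Module.Dual ℝ E →ₗ[ℝ] E}
    {S : E →ₗ[ℝ] Module.Dual ℝ E}
    {c C : ℝ} (hc : 0 < c) (hC : 0 < C) (hH : IsSPD H) (hS : Function.Bijective S)
    (hsymm : ∀ x y, S x y = S y x)
    (h : SpectrallyEquiv c C H (linInv S)) {x : E} {f : Module.Dual ℝ E} (hf : H f = x) :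
    f x ≤ C * S x x := by
  refine apply_le_of_form_le (E := Module.Dual ℝ E) (F := E) LinearMap.id (linInv S) ?_ ?_
    hC (linInv_apply_apply hS x) ?_
  · intro f g
    obtain ⟨u, rfl⟩ := hS.2 f
    obtain ⟨v, rfl⟩ := hS.2 g
    simp [linInv_apply_apply hS, hsymm u v]
  · intro f
    exact (mul_nonneg hc.le (hH.nonneg f)).trans (h f).1
  · have := (h f).2
    rwa [hf] at this

/-! ### Field of values of the block triangular preconditioned saddle point operator. -/

variable [FiniteDimensional ℝ E] [FiniteDimensional ℝ F]

/-- Field-of-values and norm bounds for the block triangular preconditioner applied to the saddle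
point operator; `(y₁, y₂)` is the image of `(w, p)`, and `φ, ψ, φ', ψ'` are the preimages of
`w, p, y₁, y₂` under the diagonal blocks. -/
theorem fov_bounds {A T : E →ₗ[ℝ] Module.Dual ℝ E} {B : E →ₗ[ℝ] Module.Dual ℝ F}
    {Hw : Module.Dual ℝ E →ₗ[ℝ] E} {Hp : Module.Dual ℝ F →ₗ[ℝ] F}
    {c₁ c₂ c₁w c₂w c₁p c₂p ρ : ℝ} (hc₁ : 0 < c₁) (hc₂ : 0 < c₂)
    (hc₁w : 0 < c₁w) (hc₂w : 0 < c₂w) (hc₁p : 0 < c₁p) (hc₂p : 0 < c₂p) (hρ₀ : 0 ≤ ρ) (hρ : ρ < 1)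
    (hAs : ∀ x y, A x y = A y x) (hA : ∀ x, x ≠ 0 → 0 < A x x)
    (hTs : ∀ x y, T x y = T y x) (hT : ∀ x, x ≠ 0 → 0 < T x x)
    (hTA : ∀ x, c₁ ^ 2 * T x x ≤ A x x) (hAT : ∀ x, A x x ≤ c₂ ^ 2 * T x x)
    (hHw : IsSPD Hw) (hHp : IsSPD Hp)
    (hw : SpectrallyEquiv c₁w c₂w Hw (linInv A))
    (hp : SpectrallyEquiv c₁p c₂p Hp (linInv (B ∘ₗ linInv T ∘ₗ B.flip)))
    (hI : ∀ x, √(A (x - Hw (A x)) (x - Hw (A x))) ≤ ρ * √(A x x))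
    {w y₁ : E} {p y₂ : F} {φ φ' : Module.Dual ℝ E} {ψ ψ' : Module.Dual ℝ F}
    (hφ : Hw φ = w) (hψ : Hp ψ = p) (hφ' : φ' = A w + B.flip p) (hy₁ : Hw φ' = y₁)
    (hψ' : ψ' = B (y₁ - w)) (hy₂ : Hp ψ' = y₂) :
    (1 - ρ) / 2 * min c₂w⁻¹ (c₂w⁻¹ * (c₂ ^ 2)⁻¹ * c₂p⁻¹) * (φ w + ψ p) ≤ φ' w + ψ' p ∧
    φ' y₁ + ψ' y₂ ≤
      max (2 * c₁w⁻¹) (c₁p⁻¹ * (c₁ ^ 2)⁻¹ * (1 + c₁w⁻¹)) ^ 2 * (φ w + ψ p) := by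
  have hAn : ∀ x, 0 ≤ A x x := fun x => by
    rcases eq_or_ne x 0 with rfl | h
    · simp
    · exact (hA x h).le
  have hTn : ∀ x, 0 ≤ T x x := fun x => by
    rcases eq_or_ne x 0 with rfl | h
    · simp
    · exact (hT x h).le
  have hAb := bijective_of_form_pos hA
  have hTb := bijective_of_form_pos hT
  set S := B ∘ₗ linInv T ∘ₗ B.flip with hS
  have hSb := hp.bijective hc₁p hHp
  have hSs : ∀ u v, S u v = S v u := by
    intro u v
    obtain ⟨a, ha⟩ := hTb.2 (B.flip u)
    obtain ⟨b, hb⟩ := hTb.2 (B.flip v)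
    have h1 : S u v = T b a := by
      simp only [hS, LinearMap.comp_apply]
      rw [linInv_eq_of_apply_eq hTb ha, hb, LinearMap.flip_apply]
    have h2 : S v u = T a b := by
      simp only [hS, LinearMap.comp_apply]
      rw [linInv_eq_of_apply_eq hTb hb, ha, LinearMap.flip_apply]
    rw [h1, h2, hTs]
  -- `A⁻¹` and `T⁻¹` on the range of `Bᵀ`
  have hcmp : ∀ (v : F) (z : E), A z = B.flip v →
      A z z ≤ (c₁ ^ 2)⁻¹ * S v v ∧ S v v ≤ c₂ ^ 2 * A z z := by
    intro v z hz
    obtain ⟨t, ht⟩ := hTb.2 (B.flip v)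
    have hSv : S v v = B.flip v t := by
      simp only [hS, LinearMap.comp_apply]
      rw [linInv_eq_of_apply_eq hTb ht, LinearMap.flip_apply]
    rw [hSv, hz]
    constructor
    · refine apply_le_of_form_le (E := E) (F := Module.Dual ℝ E)
        (LinearMap.id (R := ℝ) (M := Module.Dual ℝ E)).flip T (fun x y => hTs y x) hTn
        (inv_pos.2 (pow_pos hc₁ 2)) ht ?_
      rw [le_inv_mul_iff₀ (pow_pos hc₁ 2), ← hz]
      exact hTA z
    · refine apply_le_of_form_le (E := E) (F := Module.Dual ℝ E)
        (LinearMap.id (R := ℝ) (M := Module.Dual ℝ E)).flip A (fun x y => hAs y x) hAn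
        (pow_pos hc₂ 2) hz ?_
      rw [← ht]
      exact hAT t
  set a := c₁w⁻¹ with ha
  set q := c₁p⁻¹ * (c₁ ^ 2)⁻¹ with hq
  have ha0 : 0 < a := inv_pos.2 hc₁w
  have hq0 : 0 < q := by positivity
  have hz_le : ∀ (v : F) (z : E) (χ : Module.Dual ℝ F), A z = B.flip v → Hp χ = v →
      A z z ≤ q * χ v := by
    intro v z χ hz hχ
    have h1 := (hcmp v z hz).1
    have h2 := le_of_spectrallyEquiv_left hc₁p hHp hSb hp hχ
    calc A z z ≤ (c₁ ^ 2)⁻¹ * S v v := h1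
      _ ≤ (c₁ ^ 2)⁻¹ * (c₁p⁻¹ * χ v) := by gcongr
      _ = q * χ v := by rw [hq]; ring
  -- With `z = A⁻¹ Bᵀ p` and `z' = A⁻¹ Bᵀ y₂` every occurrence of `B` becomes an `A`-inner product.
  obtain ⟨z, hz⟩ := hAb.2 (B.flip p)
  obtain ⟨z', hz'⟩ := hAb.2 (B.flip y₂)
  -- the symmetric form of `Hw A`
  have hHs : ∀ x y, A x (Hw (A y)) = A y (Hw (A x)) := fun x y => hHw.1 _ _
  have hHn : ∀ x, 0 ≤ A x (Hw (A x)) := fun x => hHw.nonneg _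
  have hHle : ∀ x, A x (Hw (A x)) ≤ a * A x x := by
    intro x
    have := (hw (A x)).1
    rw [linInv_apply_apply hAb] at this
    rwa [ha, le_inv_mul_iff₀ hc₁w]
  have hHge : ∀ x, A x x ≤ c₂w * A x (Hw (A x)) := by
    intro x
    have := (hw (A x)).2
    rwa [linInv_apply_apply hAb] at this
  have hNle : ∀ x y, |A (x - Hw (A x)) y| ≤ ρ * √(A x x) * √(A y y) := fun x y =>
    (abs_form_le A hAs hAn _ _).trans (mul_le_mul_of_nonneg_right (hI x) (Real.sqrt_nonneg _))
  have hy₁' : y₁ = Hw (A w) + Hw (A z) := by rw [← hy₁, hφ', map_add, hz]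
  have hBp : ∀ x, B x p = A z x := fun x => by rw [hz, LinearMap.flip_apply]
  have hBy : ∀ x, B x y₂ = A z' x := fun x => by rw [hz', LinearMap.flip_apply]
  have hφw : A w w ≤ a * φ w := le_of_spectrallyEquiv_left hc₁w hHw hAb hw hφ
  have hφw' : φ w ≤ c₂w * A w w :=
    le_of_spectrallyEquiv_right hc₁w hc₂w hHw hAb hAs hw hφ
  have hψp : ψ p ≤ c₂p * S p p :=
    le_of_spectrallyEquiv_right hc₁p hc₂p hHp hSb hSs hp hψ
  have hφ0 : 0 ≤ φ w := by rw [← hφ]; exact hHw.nonneg φ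
  have hψ0 : 0 ≤ ψ p := by rw [← hψ]; exact hHp.nonneg ψ
  have hφ'0 : 0 ≤ φ' y₁ := by rw [← hy₁]; exact hHw.nonneg φ'
  have hψ'0 : 0 ≤ ψ' y₂ := by rw [← hy₂]; exact hHp.nonneg ψ'
  constructor
  -- The terms `A z w` coming from `Bᵀ p` and from `-B w` cancel.
  · have hform : φ' w + ψ' p = A w w + A z (Hw (A w)) + A z (Hw (A z)) := by
      rw [hφ', hψ', hBp, hy₁', ← hz]
      simp only [LinearMap.add_apply, map_add, map_sub]
      ring
    -- This bounds the mixed term below by `-(h(w, w) + h(z, z)) / 2`, where `h(u, v) = A u (Hw (A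
    -- v))`; the contraction property then gives `h(w, w) ≤ (1 + ρ) A w w`.
    have h1 := hHn (w + z)
    simp only [map_add, LinearMap.add_apply, hHs w z] at h1
    have h2 := (abs_le.1 (hNle w w)).1
    rw [mul_assoc, Real.mul_self_sqrt (hAn w), map_sub, LinearMap.sub_apply,
      hAs (Hw (A w)) w] at h2
    have h3 := mul_nonneg hρ₀ (hHn z)
    have h4 : (1 - ρ) / 2 * (A w w + A z (Hw (A z))) ≤ φ' w + ψ' p := by
      rw [hform]
      linarith
    refine le_trans ?_ h4
    rw [mul_assoc]
    refine mul_le_mul_of_nonneg_left ?_ (by linarith)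
    rw [mul_add]
    refine add_le_add ?_ ?_
    · calc min c₂w⁻¹ (c₂w⁻¹ * (c₂ ^ 2)⁻¹ * c₂p⁻¹) * φ w ≤ c₂w⁻¹ * φ w :=
            mul_le_mul_of_nonneg_right (min_le_left _ _) hφ0
        _ ≤ A w w := by rwa [inv_mul_le_iff₀ hc₂w]
    · calc min c₂w⁻¹ (c₂w⁻¹ * (c₂ ^ 2)⁻¹ * c₂p⁻¹) * ψ p
          ≤ c₂w⁻¹ * (c₂ ^ 2)⁻¹ * c₂p⁻¹ * ψ p :=
            mul_le_mul_of_nonneg_right (min_le_right _ _) hψ0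
        _ = c₂w⁻¹ * ((c₂ ^ 2)⁻¹ * (c₂p⁻¹ * ψ p)) := by ring
        _ ≤ c₂w⁻¹ * A z z := by
            gcongr
            rw [inv_mul_le_iff₀ (pow_pos hc₂ 2)]
            refine le_trans ?_ (hcmp p z hz).2
            rwa [inv_mul_le_iff₀ hc₂p]
        _ ≤ A z (Hw (A z)) := by rw [inv_mul_le_iff₀ hc₂w]; exact hHge z
  -- Splitting `y₁ - w` into `-(w - Hw A w)` and `Hw A z` exposes the factor `I - Hw A`, which the
  -- contraction hypothesis controls.
  · have hform : φ' y₁ + ψ' y₂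
        = A w y₁ + A z y₁ - A (w - Hw (A w)) z' + A z (Hw (A z')) := by
      rw [hφ', hψ', hBy, ← hz, hAs _ z', hHs z z']
      have h1 : A z' y₁ = A z' (Hw (A w)) + A z' (Hw (A z)) := by rw [hy₁', map_add]
      simp only [LinearMap.add_apply, map_sub, h1]
      ring
    have hle1 : A w w ≤ a * φ w := hφw
    have hle2 : A z z ≤ q * ψ p := hz_le p z ψ hz hψ
    have hle3 : A y₁ y₁ ≤ a * φ' y₁ := le_of_spectrallyEquiv_left hc₁w hHw hAb hw hy₁
    have hle4 : A z' z' ≤ q * ψ' y₂ := hz_le y₂ z' ψ' hz' hy₂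
    have e1 := le_of_abs_le (abs_form_le A hAs hAn w y₁)
    have e2 := le_of_abs_le (abs_form_le A hAs hAn z y₁)
    have e3 := neg_le_of_abs_le (hNle w z')
    -- Cauchy-Schwarz for the form of `Hw` on the dual space, followed by `Hw ≤ a A⁻¹`.
    have e4 : A z (Hw (A z')) ≤ a * (√(A z z) * √(A z' z')) := by
      have h1 := abs_form_le (E := Module.Dual ℝ E)
        ((LinearMap.id (R := ℝ) (M := Module.Dual ℝ E)).flip ∘ₗ Hw)
        (fun f g => by simpa using (hHw.1 g f)) (fun f => by simpa using hHw.nonneg f)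
        (A z') (A z)
      simp only [LinearMap.comp_apply, LinearMap.flip_apply, LinearMap.id_apply] at h1
      refine (le_of_abs_le h1).trans ?_
      calc √(A z' (Hw (A z'))) * √(A z (Hw (A z)))
          ≤ √(a * A z' z') * √(a * A z z) := by
            gcongr
            · exact hHle z'
            · exact hHle z
        _ = a * (√(A z z) * √(A z' z')) := by
            rw [Real.sqrt_mul ha0.le, Real.sqrt_mul ha0.le]
            nth_rw 3 [← Real.mul_self_sqrt ha0.le]
            ring
    have s1 := Real.sq_sqrt (hAn w)
    have s2 := Real.sq_sqrt (hAn z)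
    have s3 := Real.sq_sqrt (hAn y₁)
    have s4 := Real.sq_sqrt (hAn z')
    have n1 := Real.sqrt_nonneg (A w w)
    have n2 := Real.sqrt_nonneg (A z z)
    have n3 := Real.sqrt_nonneg (A y₁ y₁)
    have n4 := Real.sqrt_nonneg (A z' z')
    set x := √(A w w)
    set ζ := √(A z z)
    set y := √(A y₁ y₁)
    set t := √(A z' z')
    set ξ := max (2 * a) (q * (1 + a)) with hξ
    have hξ1 : 2 * a ≤ ξ := le_max_left _ _
    have hξ2 : q * (1 + a) ≤ ξ := le_max_right _ _
    have hξ0 : 0 ≤ ξ := by linarith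
    set Y := φ' y₁ + ψ' y₂ with hY
    have hY0 : 0 ≤ Y := add_nonneg hφ'0 hψ'0
    have hYle : Y ≤ x * y + ζ * y + x * t + a * (ζ * t) := by
      have : ρ * x * t ≤ x * t := by
        rw [mul_assoc]
        exact mul_le_of_le_one_left (mul_nonneg n1 n4) hρ.le
      linarith
    -- Cauchy-Schwarz for four products with weights `1, 1, 1, a`, proved by Lagrange's identity.
    -- The two factors are exactly those that `ξ` times the squared norms of the argument and of the
    -- image dominate.
    have hcs : (x * y + ζ * y + x * t + a * (ζ * t)) ^ 2
        ≤ (2 * x ^ 2 + (1 + a) * ζ ^ 2) * (2 * y ^ 2 + (1 + a) * t ^ 2) := by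
      have : (2 * x ^ 2 + (1 + a) * ζ ^ 2) * (2 * y ^ 2 + (1 + a) * t ^ 2)
          - (x * y + ζ * y + x * t + a * (ζ * t)) ^ 2
          = (x * y - ζ * y) ^ 2 + (x * t - x * y) ^ 2 + (ζ * t - x * y) ^ 2
            + a * ((x * t - ζ * y) ^ 2 + (ζ * t - ζ * y) ^ 2 + (x * t - ζ * t) ^ 2) := by
        ring
      have : 0 ≤ (2 * x ^ 2 + (1 + a) * ζ ^ 2) * (2 * y ^ 2 + (1 + a) * t ^ 2)
          - (x * y + ζ * y + x * t + a * (ζ * t)) ^ 2 := by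
        rw [this]
        positivity
      linarith
    have b1 : 2 * x ^ 2 + (1 + a) * ζ ^ 2 ≤ ξ * (φ w + ψ p) := by
      calc 2 * x ^ 2 + (1 + a) * ζ ^ 2 ≤ 2 * (a * φ w) + (1 + a) * (q * ψ p) := by
            rw [s1, s2]; gcongr
        _ = (2 * a) * φ w + (q * (1 + a)) * ψ p := by ring
        _ ≤ ξ * φ w + ξ * ψ p := by gcongr
        _ = _ := by ring
    have b2 : 2 * y ^ 2 + (1 + a) * t ^ 2 ≤ ξ * Y := by
      calc 2 * y ^ 2 + (1 + a) * t ^ 2 ≤ 2 * (a * φ' y₁) + (1 + a) * (q * ψ' y₂) := by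
            rw [s3, s4]; gcongr
        _ = (2 * a) * φ' y₁ + (q * (1 + a)) * ψ' y₂ := by ring
        _ ≤ ξ * φ' y₁ + ξ * ψ' y₂ := by gcongr
        _ = _ := by rw [hY]; ring
    -- The squared norm `Y` of the image occurs on both sides; it cancels unless it is zero.
    have hfin : Y * Y ≤ (ξ ^ 2 * (φ w + ψ p)) * Y := by
      calc Y * Y = Y ^ 2 := by ring
        _ ≤ (x * y + ζ * y + x * t + a * (ζ * t)) ^ 2 := by gcongr
        _ ≤ _ := hcs
        _ ≤ (ξ * (φ w + ψ p)) * (ξ * Y) := by gcongr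
        _ = _ := by ring
    rcases hY0.eq_or_lt with h0 | h0
    · rw [← h0]; positivity
    · exact le_of_mul_le_mul_right hfin h0

end Abstract

/-! ### Raviart-Thomas fields on a simplex -/

section SimplexEstimates

variable {n d : ℕ} (T : Simp n d)

theorem exists_weights_of_mem {x : Pt n} (hx : x ∈ T.closedInterior) :
    ∃ w : Fin (d + 1) → ℝ, (∀ l, 0 ≤ w l ∧ w l ≤ 1) ∧ ∑ l, w l = 1 ∧ x = ∑ l, w l • T.points l := by
  obtain ⟨w, h1, h2, rfl⟩ := hx
  exact ⟨w, fun l => h2 l, h1, Finset.affineCombination_eq_linear_combination _ _ _ h1⟩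

theorem mem_closedInterior_iff {w : Fin (d + 1) → ℝ} (h1 : ∑ l, w l = 1) :
    ∑ l, w l • T.points l ∈ T.closedInterior ↔ ∀ l, 0 ≤ w l ∧ w l ≤ 1 := by
  rw [← Finset.affineCombination_eq_linear_combination _ _ _ h1,
    Affine.Simplex.affineCombination_mem_closedInterior_iff h1]
  rfl

/-- A barycentric coordinate changes at most at the rate of the inverse height. -/
theorem abs_mul_height_le (c : Fin (d + 1) → ℝ) (hc : ∑ l, c l = 0) (k : Fin (d + 1)) :
    |c k| * height T k ≤ ‖∑ l, c l • T.points l‖ := by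
  classical
  rcases eq_or_ne (c k) 0 with h0 | h0
  · simp [h0]
  set v := ∑ l, c l • T.points l with hv
  set u : Fin (d + 1) → ℝ := fun l => (if l = k then 1 else 0) - (c k)⁻¹ * c l with hu
  have hu1 : ∑ l, u l = 1 := by
    simp [hu, Finset.sum_sub_distrib, ← Finset.mul_sum, hc]
  have huk : u k = 0 := by simp [hu, h0]
  -- Subtracting `v / c_k` from the vertex `k` cancels its own barycentric coordinate, so one lands
  -- in the opposite hyperplane, at distance `‖v‖ / |c_k|`.
  have hmem : T.points k - (c k)⁻¹ • v ∈ affineSpan ℝ (T.points '' {k}ᶜ) := by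
    have h := affineCombination_mem_affineSpan_image (k := ℝ) (s := Finset.univ) (p := T.points)
      (s' := {k}ᶜ) (w := u) hu1 (by
        intro l _ hl
        have : l = k := by simpa using hl
        rw [this, huk])
    rw [Finset.affineCombination_eq_linear_combination _ _ _ hu1] at h
    have he : ∑ l, u l • T.points l = T.points k - (c k)⁻¹ • v := by
      simp [hu, hv, sub_smul, Finset.sum_sub_distrib, mul_smul, Finset.smul_sum, ite_smul]
    rwa [he] at h
  have hle : height T k ≤ |c k|⁻¹ * ‖v‖ := by
    refine (Metric.infDist_le_dist_of_mem hmem).trans_eq ?_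
    rw [dist_eq_norm, sub_sub_cancel, norm_smul, norm_inv, Real.norm_eq_abs]
  rwa [le_inv_mul_iff₀ (abs_pos.2 h0)] at hle

/-- A ball in the simplex has a radius at most the height. -/
theorem le_height_of_ball_subset (hd : 0 < d) (k : Fin (d + 1)) {c : Pt n} {r : ℝ}
    (hc : c ∈ affineSpan ℝ (Set.range T.points)) (hr : 0 < r)
    (hball : Metric.closedBall c r ∩ (affineSpan ℝ (Set.range T.points) : Set (Pt n)) ⊆
      T.closedInterior) : r ≤ height T k := by
  classical
  have hcT : c ∈ T.closedInterior := hball ⟨Metric.mem_closedBall_self hr.le, hc⟩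
  obtain ⟨u, hu01, hu1, hcu⟩ := exists_weights_of_mem T hcT
  have hne : (affineSpan ℝ (T.points '' {k}ᶜ) : Set (Pt n)).Nonempty := by
    rw [affineSpan_nonempty]
    have : Nontrivial (Fin (d + 1)) := Fin.nontrivial_iff_two_le.2 (by omega)
    obtain ⟨j, hj⟩ := exists_ne k
    exact ⟨_, j, by simpa using hj, rfl⟩
  refine (Metric.le_infDist hne).2 fun y hy => ?_
  obtain ⟨fs, w, hfs, hw, hyw⟩ := eq_affineCombination_of_mem_affineSpan_image hy
  -- extend the weights by zero
  set w' : Fin (d + 1) → ℝ := fun l => if l ∈ fs then w l else 0 with hw'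
  have hw'1 : ∑ l, w' l = 1 := by simpa [hw'] using hw
  have hw'k : w' k = 0 := by
    have : k ∉ fs := fun h => by simpa using hfs h
    simp [hw', this]
  have hyw' : y = ∑ l, w' l • T.points l := by
    rw [hyw, Finset.affineCombination_eq_linear_combination _ _ _ hw]
    simp [hw', ite_smul]
  -- Moving from the centre of the ball by `t (p_k - y)` raises the `k`-th barycentric coordinate by
  -- `t`. It starts nonnegative and stays at most `1` inside the ball, so `t ≤ 1`.
  have key : ∀ t : ℝ, 0 ≤ t → t * ‖T.points k - y‖ ≤ r → t ≤ 1 := by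
    intro t ht htr
    set z : Fin (d + 1) → ℝ := fun l => u l + t * ((if l = k then 1 else 0) - w' l) with hz
    have hz1 : ∑ l, z l = 1 := by
      simp [hz, Finset.sum_add_distrib, ← Finset.mul_sum, Finset.sum_sub_distrib, hw'1, hu1]
    have hzs : ∑ l, z l • T.points l = c + t • (T.points k - y) := by
      rw [hcu, hyw']
      simp [hz, add_smul, mul_smul, sub_smul, Finset.sum_add_distrib, Finset.sum_sub_distrib,
        Finset.smul_sum, smul_sub, ite_smul]
    have hmem : ∑ l, z l • T.points l ∈ T.closedInterior := by
      refine hball ⟨?_, ?_⟩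
      · rw [hzs, Metric.mem_closedBall, dist_eq_norm, add_sub_cancel_left, norm_smul,
          Real.norm_of_nonneg ht]
        exact htr
      · rw [← Finset.affineCombination_eq_linear_combination _ _ _ hz1]
        exact affineCombination_mem_affineSpan hz1 _
    have := ((mem_closedInterior_iff T hz1).1 hmem k).2
    simp only [hz, if_true, hw'k] at this
    have := (hu01 k).1
    linarith
  rw [dist_eq_norm]
  have hpos : 0 < ‖T.points k - y‖ := by
    by_contra h
    have h0 : ‖T.points k - y‖ = 0 := le_antisymm (not_lt.1 h) (norm_nonneg _)
    -- If `y` were the vertex itself, no displacement would occur and any `t`, for example `2`,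
    -- would be admissible.
    have := key 2 (by norm_num) (by rw [h0]; simpa using hr.le)
    norm_num at this
  have := key (r / ‖T.points k - y‖) (by positivity) (by rw [div_mul_cancel₀ _ hpos.ne'])
  rwa [div_le_one hpos] at this

variable {T}

theorem ShapeRegular.height_pos {σ : ℝ} (h : ShapeRegular σ T) (hd : 0 < d) (k : Fin (d + 1)) :
    0 < height T k := by
  obtain ⟨c, hc, r, hr, hball, -⟩ := h
  exact hr.trans_le (le_height_of_ball_subset T hd k hc hr hball)

/-- The numerator `‖x - p_k‖` is at most the diameter, hence at most `σ r`, and the inscribed radius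
`r` is at most the height in the denominator. -/
theorem ShapeRegular.norm_rtBasis_le {σ : ℝ} (h : ShapeRegular σ T) (hd : 0 < d)
    (k : Fin (d + 1)) {x : Pt n} (hx : x ∈ T.closedInterior) : ‖rtBasis T k x‖ ≤ |σ| := by
  have hk := h.height_pos hd k
  obtain ⟨c, hc, r, hr, hball, hdiam⟩ := h
  have hle := le_height_of_ball_subset T hd k hc hr hball
  rw [rtBasis, norm_smul, norm_inv, Real.norm_of_nonneg hk.le, inv_mul_le_iff₀ hk]
  calc ‖x - T.points k‖ = dist x (T.points k) := (dist_eq_norm _ _).symm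
    _ ≤ Metric.diam T.closedInterior :=
      Metric.dist_le_diam_of_mem (isCompact_closedInterior T).isBounded hx
        (T.point_mem_closedInterior k)
    _ ≤ σ * r := hdiam
    _ ≤ |σ| * height T k := by
      gcongr
      exact le_abs_self σ
    _ = height T k * |σ| := mul_comm _ _

variable (T)

/-- The normal component of a Raviart-Thomas field towards the face `k` bounds the field. -/
theorem height_mul_abs_le_norm (α : Fin (d + 1) → ℝ) (w : Fin (d + 1) → ℝ) (hw : ∑ l, w l = 1)
    (k : Fin (d + 1)) :
    |(∑ j, α j * (height T j)⁻¹) * w k - α k * (height T k)⁻¹| * height T k ≤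
      ‖∑ j, α j • rtBasis T j (∑ l, w l • T.points l)‖ := by
  set β : Fin (d + 1) → ℝ := fun j => α j * (height T j)⁻¹ with hβ
  -- The field is `∑ (s w_l - β_l) p_l` with `s = ∑ β_j`, and these coefficients sum to zero because
  -- `∑ w_l = 1`.
  have h := abs_mul_height_le T (fun l => (∑ j, β j) * w l - β l)
    (by rw [Finset.sum_sub_distrib, ← Finset.mul_sum, hw, mul_one, sub_self]) k
  refine h.trans_eq (congrArg norm ?_)
  have hterm : ∀ (x : Pt n) j, α j • rtBasis T j x = β j • x - β j • T.points j := fun x j => by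
    rw [rtBasis, smul_smul, smul_sub]
  rw [Finset.sum_congr rfl fun j _ => hterm _ j, Finset.sum_sub_distrib, ← Finset.sum_smul,
    Finset.smul_sum, ← Finset.sum_sub_distrib]
  exact Finset.sum_congr rfl fun l _ => by rw [sub_smul, mul_smul]

/-- The simplex, contracted by the factor `1 / 4` towards the vertex `j`. -/
def corner (j : Fin (d + 1)) : Set (Pt n) :=
  AffineMap.homothety (T.points j) (1 / 4 : ℝ) '' T.closedInterior

theorem exists_weights_of_mem_corner (j : Fin (d + 1)) {x : Pt n} (hx : x ∈ corner T j) :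
    ∃ w : Fin (d + 1) → ℝ, (∀ l, 0 ≤ w l ∧ w l ≤ 1) ∧ ∑ l, w l = 1 ∧
      x = ∑ l, w l • T.points l ∧ 3 / 4 ≤ w j ∧ ∀ l, l ≠ j → w l ≤ 1 / 4 := by
  classical
  obtain ⟨y, hy, rfl⟩ := hx
  obtain ⟨u, hu01, hu1, rfl⟩ := exists_weights_of_mem T hy
  refine ⟨fun l => 1 / 4 * u l + 3 / 4 * (if l = j then 1 else 0), fun l => ?_, ?_, ?_, ?_, ?_⟩
  · have := hu01 l
    dsimp only
    split_ifs <;> constructor <;> linarith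
  · simp only [Finset.sum_add_distrib, ← Finset.mul_sum, hu1]
    simp
    norm_num
  · simp only [AffineMap.homothety_apply, vsub_eq_sub, vadd_eq_add, add_smul, mul_smul,
      Finset.sum_add_distrib, ← Finset.smul_sum, ite_smul, one_smul, zero_smul,
      Finset.sum_ite_eq', Finset.mem_univ, if_true, smul_sub]
    module
  · have := hu01 j
    simp only [if_true]
    linarith
  · intro l hl
    have := hu01 l
    simp only [hl, if_false]
    linarith

theorem corner_subset (j : Fin (d + 1)) : corner T j ⊆ T.closedInterior := by
  intro x hx
  obtain ⟨w, hw01, hw1, rfl, -⟩ := exists_weights_of_mem_corner T j hx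
  exact (mem_closedInterior_iff T hw1).2 hw01

theorem measurableSet_corner (j : Fin (d + 1)) : MeasurableSet (corner T j) :=
  ((isCompact_closedInterior T).image (AffineMap.homothety_continuous _ _)).measurableSet

theorem measureReal_corner (j : Fin (d + 1)) :
    (μHE[d] : Measure (Pt n)).real (corner T j) =
      (1 / 4) ^ d * (μHE[d] : Measure (Pt n)).real T.closedInterior := by
  rw [corner, measureReal_def, euclideanHausdorffMeasure_homothety_image d _ (by norm_num)]
  simp [measureReal_def, ENNReal.smul_def]

/-- The affine function `s w_k - β` can be small only near the level `w_k = β / s`, so some corner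
avoids it. If `|s| ≤ 2|β|`, away from the vertex `k` one has `|s w_k| ≤ |β| / 2`; otherwise, near
that vertex, `|s w_k| ≥ 3|β| / 2`. The first case needs a second vertex, hence `0 < d`. -/
theorem sq_le_of_mem_corner {s β : ℝ} {k : Fin (d + 1)} (hd : 0 < d) :
    ∃ j, ∀ w : Fin (d + 1) → ℝ, (∀ l, 0 ≤ w l ∧ w l ≤ 1) → 3 / 4 ≤ w j →
      (∀ l, l ≠ j → w l ≤ 1 / 4) → |β| / 2 ≤ |s * w k - β| := by
  have : Nontrivial (Fin (d + 1)) := Fin.nontrivial_iff_two_le.2 (by omega)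
  obtain ⟨i, hi⟩ := exists_ne k
  by_cases hs : |s| ≤ 2 * |β|
  · refine ⟨i, fun w hw _ h2 => ?_⟩
    have h3 := h2 k hi.symm
    have h4 : |s * w k| ≤ |β| / 2 := by
      rw [abs_mul, abs_of_nonneg (hw k).1]
      nlinarith [abs_nonneg s, abs_nonneg β]
    have := abs_sub_abs_le_abs_sub β (s * w k)
    rw [abs_sub_comm] at this
    linarith
  · refine ⟨k, fun w hw h1 _ => ?_⟩
    have h4 : 3 / 2 * |β| ≤ |s * w k| := by
      rw [abs_mul, abs_of_nonneg (hw k).1]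
      nlinarith [abs_nonneg s, abs_nonneg β]
    have := abs_sub_abs_le_abs_sub (s * w k) β
    linarith

/-- The integral of a quadratic form in a Raviart-Thomas field controls the normal components. -/
theorem sq_mul_measure_le_integral (hd : 0 < d) (k : Fin (d + 1)) (hk : 0 < height T k)
    (α : Fin (d + 1) → ℝ) {g : Pt n → ℝ} {m : ℝ} (hm : 0 ≤ m)
    (hg : IntegrableOn g T.closedInterior (μHE[d] : Measure (Pt n)))
    (hle : ∀ x ∈ T.closedInterior, m * ‖∑ j, α j • rtBasis T j x‖ ^ 2 ≤ g x) :
    m * (α k ^ 2 / 4) * ((1 / 4) ^ d * (μHE[d] : Measure (Pt n)).real T.closedInterior) ≤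
      ∫ x in T.closedInterior, g x ∂(μHE[d]) := by
  obtain ⟨j, hj⟩ := sq_le_of_mem_corner (s := ∑ j, α j * (height T j)⁻¹)
    (β := α k * (height T k)⁻¹) (k := k) hd
  have hpt : ∀ x ∈ corner T j, m * (α k ^ 2 / 4) ≤ g x := by
    intro x hx
    refine le_trans ?_ (hle x (corner_subset T j hx))
    obtain ⟨w, hw01, hw1, rfl, h3, h4⟩ := exists_weights_of_mem_corner T j hx
    have h1 := hj w hw01 h3 h4
    have h2 := height_mul_abs_le_norm T α w hw1 k
    have h5 : |α k| / 2 ≤ ‖∑ j, α j • rtBasis T j (∑ l, w l • T.points l)‖ := by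
      refine le_trans ?_ h2
      calc |α k| / 2 = |α k * (height T k)⁻¹| / 2 * height T k := by
            rw [abs_mul, abs_of_pos (inv_pos.2 hk)]
            field_simp
        _ ≤ _ := by gcongr
    have h6 : α k ^ 2 / 4 = (|α k| / 2) ^ 2 := by rw [div_pow, sq_abs]; norm_num
    rw [h6]
    gcongr
  have hfin : (μHE[d] : Measure (Pt n)) (corner T j) ≠ ⊤ :=
    ((measure_mono (corner_subset T j)).trans_lt (measure_closedInterior_lt_top T)).ne
  calc m * (α k ^ 2 / 4) * ((1 / 4) ^ d * (μHE[d] : Measure (Pt n)).real T.closedInterior)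
      = m * (α k ^ 2 / 4) * (μHE[d] : Measure (Pt n)).real (corner T j) := by
        rw [measureReal_corner]
    _ ≤ ∫ x in corner T j, g x ∂(μHE[d]) :=
        setIntegral_ge_of_const_le_real (measurableSet_corner T j) hfin hpt
          (hg.mono_set (corner_subset T j))
    _ ≤ ∫ x in T.closedInterior, g x ∂(μHE[d]) := by
        refine setIntegral_mono_set hg ?_ (corner_subset T j).eventuallyLE
        refine (ae_restrict_iff' (isCompact_closedInterior T).measurableSet).2 (.of_forall ?_)
        intro x hx
        exact (mul_nonneg hm (sq_nonneg _)).trans (hle x hx)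

end SimplexEstimates

/-! ### The local mass matrix and its diagonal -/

theorem inner_map_sum_le {E ι : Type*} [NormedAddCommGroup E] [InnerProductSpace ℝ E] [Fintype ι]
    (L : E →ₗ[ℝ] E) (hs : ∀ x y, inner ℝ (L x) y = inner ℝ x (L y))
    (hn : ∀ x, 0 ≤ inner ℝ (L x) x) (u : ι → E) :
    inner ℝ (L (∑ k, u k)) (∑ k, u k) ≤ Fintype.card ι * ∑ k, inner ℝ (L (u k)) (u k) := by
  have h2 : ∀ x y, inner ℝ (L x) y ≤ (inner ℝ (L x) x + inner ℝ (L y) y) / 2 := by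
    intro x y
    have h := hn (x - y)
    have hxy : inner ℝ (L y) x = inner ℝ (L x) y := by rw [hs y x, real_inner_comm]
    simp only [map_sub, inner_sub_left, inner_sub_right, hxy] at h
    linarith
  calc inner ℝ (L (∑ k, u k)) (∑ k, u k) = ∑ j, ∑ k, inner ℝ (L (u j)) (u k) := by
        rw [map_sum, sum_inner]
        simp only [inner_sum]
    _ ≤ ∑ j, ∑ k, (inner ℝ (L (u j)) (u j) + inner ℝ (L (u k)) (u k)) / 2 :=
        Finset.sum_le_sum fun j _ => Finset.sum_le_sum fun k _ => h2 _ _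
    _ = Fintype.card ι * ∑ k, inner ℝ (L (u k)) (u k) := by
        simp only [← Finset.sum_div, Finset.sum_add_distrib, Finset.sum_const, Finset.card_univ,
          nsmul_eq_mul, ← Finset.mul_sum]
        ring

section Local

variable {n d : ℕ} (T : Simp n d) (L : Pt n →ₗ[ℝ] Pt n)

theorem continuous_rtBasis (k : Fin (d + 1)) : Continuous (rtBasis T k) := by
  unfold rtBasis
  fun_prop

theorem integrableOn_form {φ : Pt n → Pt n} (hφ : Continuous φ) :
    IntegrableOn (fun x => inner ℝ (L (φ x)) (φ x)) T.closedInterior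
      (μHE[d] : Measure (Pt n)) := by
  have h : Continuous L := LinearMap.continuous_of_finiteDimensional L
  exact integrableOn_of_continuous T ((h.comp hφ).inner hφ)

theorem integral_form_le (hs : ∀ x y, inner ℝ (L x) y = inner ℝ x (L y))
    (hn : ∀ x, 0 ≤ inner ℝ (L x) x) (α : Fin (d + 1) → ℝ) :
    ∫ x in T.closedInterior, inner ℝ (L (∑ k, α k • rtBasis T k x)) (∑ k, α k • rtBasis T k x)
        ∂(μHE[d]) ≤
      (d + 1) * ∑ k, α k * α k *
        ∫ x in T.closedInterior, inner ℝ (L (rtBasis T k x)) (rtBasis T k x) ∂(μHE[d]) := by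
  have hint : ∀ k, IntegrableOn (fun x => inner ℝ (L (rtBasis T k x)) (rtBasis T k x))
      T.closedInterior (μHE[d] : Measure (Pt n)) :=
    fun k => integrableOn_form T L (continuous_rtBasis T k)
  have hc : Continuous fun x => ∑ k, α k • rtBasis T k x := by
    have := continuous_rtBasis T
    fun_prop
  simp_rw [← integral_const_mul]
  rw [← integral_finsetSum _ fun k _ => (hint k).const_mul _, ← integral_const_mul]
  refine integral_mono (integrableOn_form T L hc)
    ((integrable_finsetSum _ fun k _ => (hint k).const_mul _).const_mul _) fun x => ?_
  have h := inner_map_sum_le L hs hn fun k => α k • rtBasis T k x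
  simp only [Fintype.card_fin, Nat.cast_add, Nat.cast_one, map_smul, real_inner_smul_left,
    real_inner_smul_right, ← mul_assoc] at h
  exact h

/-- Each diagonal entry is at most `M σ² |T|`, while the energy controls every `α k ^ 2` from below
through the corner estimate. Summation over the `d + 1` faces gives the factor in front. -/
theorem sum_integral_form_le {σ m M : ℝ} (hT : ShapeRegular σ T) (hd : 0 < d) (hm : 0 < m)
    (hM : 0 ≤ M)
    (hL : ∀ x ∈ vectorSpan ℝ (Set.range T.points),
      m * ‖x‖ ^ 2 ≤ inner ℝ (L x) x ∧ inner ℝ (L x) x ≤ M * ‖x‖ ^ 2)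
    (α : Fin (d + 1) → ℝ) :
    ∑ k, α k * α k *
        ∫ x in T.closedInterior, inner ℝ (L (rtBasis T k x)) (rtBasis T k x) ∂(μHE[d]) ≤
      (d + 1) * 4 ^ (d + 1) * σ ^ 2 * (M / m) *
        ∫ x in T.closedInterior, inner ℝ (L (∑ k, α k • rtBasis T k x))
          (∑ k, α k • rtBasis T k x) ∂(μHE[d]) := by
  have hc : Continuous fun x => ∑ k, α k • rtBasis T k x := by
    have := continuous_rtBasis T
    fun_prop
  have htan : ∀ k, ∀ x ∈ T.closedInterior,
      rtBasis T k x ∈ vectorSpan ℝ (Set.range T.points) := by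
    intro k x hx
    refine Submodule.smul_mem _ _ ?_
    rw [← direction_affineSpan]
    exact AffineSubspace.vsub_mem_direction (T.closedInterior_subset_affineSpan hx)
      (subset_affineSpan ℝ _ (Set.mem_range_self k))
  set I := ∫ x in T.closedInterior, inner ℝ (L (∑ k, α k • rtBasis T k x))
    (∑ k, α k • rtBasis T k x) ∂(μHE[d]) with hI
  set V := (μHE[d] : Measure (Pt n)).real T.closedInterior with hV
  have hV0 : 0 ≤ V := measureReal_nonneg
  have hdiag : ∀ k, ∫ x in T.closedInterior, inner ℝ (L (rtBasis T k x)) (rtBasis T k x) ∂(μHE[d])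
      ≤ M * σ ^ 2 * V := by
    intro k
    have h := setIntegral_mono_on (integrableOn_form T L (continuous_rtBasis T k))
      (integrableOn_const (μ := (μHE[d] : Measure (Pt n))) (C := M * σ ^ 2)
        (measure_closedInterior_lt_top T).ne)
      (isCompact_closedInterior T).measurableSet (fun x hx => by
        refine (hL _ (htan k x hx)).2.trans ?_
        have := hT.norm_rtBasis_le hd k hx
        rw [← sq_abs σ]
        gcongr)
    refine h.trans_eq ?_
    rw [setIntegral_const, smul_eq_mul, mul_comm]
  -- In `4 ^ (d + 1)`, one factor `4` is the square of the loss `1/2` in the pointwise bound, and `4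
  -- ^ d` is the volume ratio of the simplex and its corner.
  have hk : ∀ k, α k * α k * (M * σ ^ 2 * V) ≤ 4 ^ (d + 1) * σ ^ 2 * (M / m) * I := by
    intro k
    have h := sq_mul_measure_le_integral T hd k (hT.height_pos hd k) α hm.le
      (integrableOn_form T L hc) (fun x hx => (hL _ (Submodule.sum_mem _ fun j _ =>
        Submodule.smul_mem _ _ (htan j x hx))).1)
    calc α k * α k * (M * σ ^ 2 * V)
        = 4 ^ (d + 1) * σ ^ 2 * (M / m) * (m * (α k ^ 2 / 4) * ((1 / 4) ^ d * V)) := by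
          rw [one_div, inv_pow]
          field_simp
          ring
      _ ≤ _ := by gcongr
  calc ∑ k, α k * α k *
        ∫ x in T.closedInterior, inner ℝ (L (rtBasis T k x)) (rtBasis T k x) ∂(μHE[d])
      ≤ ∑ _k : Fin (d + 1), 4 ^ (d + 1) * σ ^ 2 * (M / m) * I :=
        Finset.sum_le_sum fun k _ =>
          (mul_le_mul_of_nonneg_left (hdiag k) (mul_self_nonneg _)).trans (hk k)
    _ = _ := by
        rw [Finset.sum_const, Finset.card_univ, Fintype.card_fin, nsmul_eq_mul]
        push_cast
        ring

end Local

/-! ### Eigenvalue bounds for the inverse permeability. -/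

section InverseForm

variable {E : Type*} [NormedAddCommGroup E] [InnerProductSpace ℝ E]

/-- Eigenvalue bounds of the inverse of a symmetric operator on an invariant subspace. -/
theorem inverse_form_bounds (K : E →ₗ[ℝ] E) (hs : ∀ x y, inner ℝ (K x) y = inner ℝ x (K y))
    (hn : ∀ x, 0 ≤ inner ℝ (K x) x) {V : Submodule ℝ E} (hV : ∀ x ∈ V, K x ∈ V) {m κ : ℝ}
    (hm : 0 < m) (hκ : 0 < κ)
    (h : ∀ x ∈ V, m * ‖x‖ ^ 2 ≤ inner ℝ (K x) x ∧ inner ℝ (K x) x ≤ κ * m * ‖x‖ ^ 2)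
    {x : E} (hx : x ∈ V) :
    (κ * m)⁻¹ * ‖K x‖ ^ 2 ≤ inner ℝ x (K x) ∧ inner ℝ x (K x) ≤ m⁻¹ * ‖K x‖ ^ 2 := by
  rw [← hs]
  constructor
  -- Cauchy-Schwarz in the form of `K` for `x` and `K x` gives `‖K x‖⁴ ≤ ⟨K x, x⟩ ⟨K (K x), K x⟩`.
  -- The upper bound applies to the last factor since `K x` stays in `V`.
  · have hcs := form_sq_le ((innerₗ E).comp K) (fun x y => by
      simp [hs x y, real_inner_comm]) (fun x => by simpa using hn x) x (K x)
    simp only [LinearMap.comp_apply, innerₗ_apply_apply, real_inner_self_eq_norm_sq] at hcs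
    have h2 := (h _ (hV x hx)).2
    rw [inv_mul_le_iff₀ (mul_pos hκ hm)]
    rcases eq_or_ne (‖K x‖ ^ 2) 0 with h0 | h0
    · rw [h0]
      exact mul_nonneg (mul_pos hκ hm).le (hn x)
    · have hpos : 0 < ‖K x‖ ^ 2 := lt_of_le_of_ne (sq_nonneg _) h0.symm
      refine le_of_mul_le_mul_right ?_ hpos
      calc ‖K x‖ ^ 2 * ‖K x‖ ^ 2 = (‖K x‖ ^ 2) ^ 2 := by ring
        _ ≤ _ := hcs
        _ ≤ inner ℝ (K x) x * (κ * m * ‖K x‖ ^ 2) := mul_le_mul_of_nonneg_left h2 (hn x)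
        _ = _ := by ring
  · rw [le_inv_mul_iff₀ hm]
    have h1 := (h x hx).1
    have h2 := real_inner_le_norm (K x) x
    have h3 : m * ‖x‖ ≤ ‖K x‖ := by
      rcases (norm_nonneg x).eq_or_lt with h0 | h0
      · rw [← h0, mul_zero]
        exact norm_nonneg _
      · refine le_of_mul_le_mul_right ?_ h0
        calc m * ‖x‖ * ‖x‖ = m * ‖x‖ ^ 2 := by ring
          _ ≤ _ := h1.trans h2
    calc m * inner ℝ (K x) x ≤ m * (‖K x‖ * ‖x‖) := by gcongr
      _ = ‖K x‖ * (m * ‖x‖) := by ring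
      _ ≤ ‖K x‖ * ‖K x‖ := by gcongr
      _ = _ := by ring

end InverseForm

/-! ### Global equivalence of the forms `a` and `aᴰ`. -/

namespace Problem

variable {n : ℕ} (D : Problem n)

theorem K_bijective (i : D.G.I) : Function.Bijective (D.P.K i) := by
  have hinj : Function.Injective (D.P.K i) := by
    rw [injective_iff_map_eq_zero]
    intro x hx
    by_contra h
    have := D.P.K_pos i x h
    simp [hx] at this
  exact ⟨hinj, LinearMap.surjective_of_injective hinj⟩

theorem K_nonneg (i : D.G.I) (x : Pt n) : 0 ≤ inner ℝ (D.P.K i x) x := by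
  rcases eq_or_ne x 0 with rfl | h
  · simp
  · exact (D.P.K_pos i x h).le

theorem Kinv_nonneg (i : D.G.I) (x : Pt n) : 0 ≤ inner ℝ (D.Kinv i x) x := by
  obtain ⟨u, rfl⟩ := (D.K_bijective i).2 x
  rw [Kinv, linInv_apply_apply (D.K_bijective i), ← D.P.K_symm]
  exact D.K_nonneg i u

/-- An injective map of a finite-dimensional invariant subspace into itself is onto, so the preimage
of a tangential vector under `K` is tangential. -/
theorem Kinv_mem (i : D.G.I) {x : Pt n} (hx : x ∈ vectorSpan ℝ (D.G.Ω i)) :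
    D.Kinv i x ∈ vectorSpan ℝ (D.G.Ω i) := by
  have hinj : Function.Injective ((D.P.K i).restrict (D.P.K_tangential i)) := fun u v h =>
    Subtype.ext ((D.K_bijective i).1 (congrArg Subtype.val h))
  obtain ⟨u, hu⟩ := LinearMap.surjective_of_injective hinj ⟨x, hx⟩
  have hu' : D.P.K i u = x := congrArg Subtype.val hu
  rw [Kinv, linInv_eq_of_apply_eq (D.K_bijective i) hu']
  exact u.2

/-- Elements lie in the closure of their subdomain, and affine hulls are closed. This makes the
tangential permeability bounds available on each element. -/
theorem vectorSpan_le (e : D.𝓣.E) :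
    vectorSpan ℝ (Set.range (D.𝓣.T e).points) ≤ vectorSpan ℝ (D.G.Ω (D.𝓣.sub e)) := by
  have hsub : (D.𝓣.T e).closedInterior ⊆ affineSpan ℝ (D.G.Ω (D.𝓣.sub e)) := by
    refine Set.Subset.trans ?_ (closure_minimal (subset_affineSpan ℝ _)
      (AffineSubspace.closed_of_finiteDimensional _))
    rw [D.𝓣.T_cover]
    exact Set.subset_iUnion₂_of_subset e rfl subset_rfl
  rw [← direction_affineSpan, ← direction_affineSpan ℝ (D.G.Ω _)]
  refine AffineSubspace.direction_le (affineSpan_le.2 ?_)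
  rintro _ ⟨k, rfl⟩
  exact hsub ((D.𝓣.T e).point_mem_closedInterior k)

theorem cForm_self_nonneg (l : D.𝓣.Λ) : 0 ≤ D.cForm l l := by
  refine Finset.sum_nonneg fun m _ => integral_nonneg fun _ => ?_
  have h1 := (D.P.γ_pos (D.𝓣.ifc m)).le
  have h2 := (D.P.Kν_pos (D.𝓣.ifc m)).le
  simp only [Pi.zero_apply]
  rw [mul_assoc _ (l m)]
  exact mul_nonneg (mul_nonneg h1 (inv_nonneg.2 h2)) (mul_self_nonneg _)

theorem aForm_self_nonneg (w : D.W) : 0 ≤ D.aForm w w :=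
  add_nonneg (Finset.sum_nonneg fun _ _ => integral_nonneg fun _ => D.Kinv_nonneg _ _)
    (D.cForm_self_nonneg _)

theorem aDForm_self_nonneg (w : D.W) : 0 ≤ D.aDForm w w :=
  add_nonneg (Finset.sum_nonneg fun _ _ => Finset.sum_nonneg fun _ _ =>
    mul_nonneg (mul_self_nonneg _) (integral_nonneg fun _ => D.Kinv_nonneg _ _))
    (D.cForm_self_nonneg _)

theorem aForm_le (w : D.W) : D.aForm w w ≤ (n + 1) * D.aDForm w w := by
  have hc := D.cForm_self_nonneg w.2
  unfold aForm aDForm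
  rw [mul_add, Finset.mul_sum]
  refine add_le_add (Finset.sum_le_sum fun e _ => ?_) ?_
  · refine (integral_form_le (D.𝓣.T e) (D.Kinv (D.𝓣.sub e)) (D.Kinv_symm _) (D.Kinv_nonneg _)
      fun k => D.tot w ⟨e, k⟩).trans ?_
    refine mul_le_mul_of_nonneg_right ?_ (Finset.sum_nonneg fun _ _ =>
      mul_nonneg (mul_self_nonneg _) (integral_nonneg fun _ => D.Kinv_nonneg _ _))
    have := D.G.dim_le (D.𝓣.sub e)
    gcongr
  · have : (0 : ℝ) ≤ n := n.cast_nonneg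
    nlinarith

/-- The face opposite to the only vertex is empty, the distance to the empty set is `0` by
convention, and so is the inverse of `0`. -/
theorem rtBasis_of_dim_zero {d : ℕ} (T : Simp n d) (hd : d = 0) (k : Fin (d + 1)) (x : Pt n) :
    rtBasis T k x = 0 := by
  subst hd
  have : ({k}ᶜ : Set (Fin 1)) = ∅ := by
    ext j
    simp [Subsingleton.elim j k]
  simp [rtBasis, height, this]

theorem aDForm_le {σ κ : ℝ} (hσ : ∀ e, ShapeRegular σ (D.𝓣.T e)) (hκ : D.P.AnisotropyLE κ)
    (w : D.W) :
    D.aDForm w w ≤ max 1 ((n + 1) * 4 ^ (n + 1) * σ ^ 2 * κ) * D.aForm w w := by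
  -- The value `1` serves the interface term, which is the same in both forms.
  set C := max 1 ((n + 1) * 4 ^ (n + 1) * σ ^ 2 * κ) with hC
  have hC1 : 1 ≤ C := le_max_left _ _
  have hc := D.cForm_self_nonneg w.2
  unfold aForm aDForm
  rw [mul_add, Finset.mul_sum]
  refine add_le_add (Finset.sum_le_sum fun e _ => ?_) (le_mul_of_one_le_left hc hC1)
  have hI : 0 ≤ ∫ x in (D.𝓣.T e).closedInterior,
      inner ℝ (D.Kinv (D.𝓣.sub e) (D.𝓣.field (D.tot w) e x)) (D.𝓣.field (D.tot w) e x)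
      ∂(μHE[D.G.dim (D.𝓣.sub e)]) := integral_nonneg fun _ => D.Kinv_nonneg _ _
  rcases Nat.eq_zero_or_pos (D.G.dim (D.𝓣.sub e)) with hd | hd
  · refine le_trans (le_of_eq ?_) (mul_nonneg (zero_le_one.trans hC1) hI)
    simp [rtBasis_of_dim_zero (D.𝓣.T e) hd]
  obtain ⟨m, hm, hK⟩ := hκ (D.𝓣.sub e)
  -- In positive dimension a nonzero tangential vector exists, and comparing its two bounds forces
  -- `κ ≥ 1`.
  have hκ1 : 1 ≤ κ := by
    have hpos : 0 < Module.finrank ℝ (vectorSpan ℝ (D.G.Ω (D.𝓣.sub e))) := by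
      rw [D.G.Ω_dim]
      exact hd
    have := Module.finrank_pos_iff.1 hpos
    obtain ⟨⟨x, hx⟩, hx0⟩ := exists_ne (0 : vectorSpan ℝ (D.G.Ω (D.𝓣.sub e)))
    have hx0' : 0 < ‖x‖ := norm_pos_iff.2 fun h => hx0 (Subtype.ext h)
    have h := (hK x hx).1.trans (hK x hx).2
    refine le_of_mul_le_mul_right ?_ (mul_pos hm (pow_pos hx0' 2))
    linarith
  have hκ0 : 0 < κ := zero_lt_one.trans_le hκ1
  have hinv : ∀ y ∈ vectorSpan ℝ (Set.range (D.𝓣.T e).points),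
      (κ * m)⁻¹ * ‖y‖ ^ 2 ≤ inner ℝ (D.Kinv (D.𝓣.sub e) y) y ∧
        inner ℝ (D.Kinv (D.𝓣.sub e) y) y ≤ m⁻¹ * ‖y‖ ^ 2 := by
    intro y hy
    have h := inverse_form_bounds (D.P.K (D.𝓣.sub e)) (D.P.K_symm _) (D.K_nonneg _)
      (D.P.K_tangential _) hm hκ0 hK (D.Kinv_mem _ (D.vectorSpan_le e hy))
    rwa [Kinv, apply_linInv_apply (D.K_bijective _)] at h
  refine (sum_integral_form_le (D.𝓣.T e) (D.Kinv (D.𝓣.sub e)) (hσ e) hd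
    (inv_pos.2 (mul_pos hκ0 hm)) (inv_pos.2 hm).le hinv
    fun k => D.tot w ⟨e, k⟩).trans ?_
  refine mul_le_mul_of_nonneg_right (le_trans ?_ (le_max_right _ _)) hI
  have h1 : m⁻¹ / (κ * m)⁻¹ = κ := by field_simp
  have := D.G.dim_le (D.𝓣.sub e)
  rw [h1]
  gcongr
  norm_num

end Problem

/-! ### The preconditioned operator -/

/-- By Cauchy-Schwarz a null vector of a semidefinite form lies in its kernel. Definiteness of `A`
thus follows from its invertibility, without an argument on the meshes. -/
theorem form_pos_of_bijective {E : Type*} [AddCommGroup E] [Module ℝ E]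
    {a : E →ₗ[ℝ] Module.Dual ℝ E} (hs : ∀ x y, a x y = a y x) (hn : ∀ x, 0 ≤ a x x)
    (ha : Function.Injective a) {x : E} (hx : x ≠ 0) : 0 < a x x := by
  refine (hn x).lt_of_ne fun h => hx (ha ?_)
  rw [map_zero]
  ext y
  have := form_sq_le a hs hn x y
  rw [← h, zero_mul] at this
  exact pow_eq_zero_iff two_ne_zero |>.1 (le_antisymm this (sq_nonneg _))

namespace Problem

variable {n : ℕ} (D : Problem n) {Hw : D.W' →ₗ[ℝ] D.W} {Hp : D.Q' →ₗ[ℝ] D.Q}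

theorem linInv_MD (hw : Function.Bijective Hw) (hp : Function.Bijective Hp) (x : D.X) :
    linInv (D.MD Hw Hp) x = (linInv Hw x.1, linInv Hp x.2) := by
  have happ : ∀ f : D.X', D.MD Hw Hp f = (Hw f.1, Hp f.2) := fun f => by
    simp [MD]
  refine linInv_eq_of_apply_eq ⟨fun f g h => ?_, fun y => ⟨(linInv Hw y.1, linInv Hp y.2), ?_⟩⟩ ?_
  · rw [happ, happ, Prod.mk.injEq] at h
    exact Prod.ext (hw.1 h.1) (hp.1 h.2)
  · rw [happ, apply_linInv_apply hw, apply_linInv_apply hp]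
  · rw [happ, apply_linInv_apply hw, apply_linInv_apply hp]

theorem ip_MD (hw : Function.Bijective Hw) (hp : Function.Bijective Hp) (x y : D.X) :
    D.ip (D.MD Hw Hp) x y = linInv Hw x.1 y.1 + linInv Hp x.2 y.2 := by
  rw [ip, D.linInv_MD hw hp, pair]

/-- Block forward substitution: the inverse of the triangular matrix sends `(f, g)` to `(Hw f, Hp (g
+ B (Hw f)))`. -/
theorem ML_calA (hw : Function.Bijective Hw) (hp : Function.Bijective Hp) (x : D.X) :
    D.ML Hw Hp (D.calA x) = (Hw (D.A x.1 + D.BT x.2),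
      Hp (D.B (Hw (D.A x.1 + D.BT x.2) - x.1))) := by
  set L : D.X →ₗ[ℝ] D.X' := ((linInv Hw).coprod 0).prod ((-D.B).coprod (linInv Hp)) with hL
  have happ : ∀ y : D.X, L y = (linInv Hw y.1, -D.B y.1 + linInv Hp y.2) := fun y => by
    simp [hL]
  refine linInv_eq_of_apply_eq (L := L) ⟨fun y z h => ?_, fun f =>
    ⟨(Hw f.1, Hp (f.2 + D.B (Hw f.1))), ?_⟩⟩ ?_
  · rw [happ, happ, Prod.mk.injEq] at h
    have h1 : y.1 = z.1 := by
      have := congrArg Hw h.1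
      rwa [apply_linInv_apply hw, apply_linInv_apply hw] at this
    have h2 : linInv Hp y.2 = linInv Hp z.2 := by
      have := h.2
      rw [h1] at this
      exact add_left_cancel this
    refine Prod.ext h1 ?_
    have := congrArg Hp h2
    rwa [apply_linInv_apply hp, apply_linInv_apply hp] at this
  · rw [happ, linInv_apply_apply hw, linInv_apply_apply hp]
    refine Prod.ext rfl ?_
    dsimp only
    abel
  · rw [happ, linInv_apply_apply hw, linInv_apply_apply hp]
    have hA : D.calA x = (D.A x.1 + D.BT x.2, -D.B x.1) := by
      simp [calA]
    rw [hA]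
    refine Prod.ext rfl ?_
    dsimp only
    rw [map_sub]
    abel

theorem ip_MD_pos (hw : IsSPD Hw) (hp : IsSPD Hp) {x : D.X} (hx : x ≠ 0) :
    0 < D.ip (D.MD Hw Hp) x x := by
  rw [D.ip_MD hw.bijective hp.bijective]
  obtain ⟨φ, hφ⟩ := hw.bijective.2 x.1
  obtain ⟨ψ, hψ⟩ := hp.bijective.2 x.2
  rw [linInv_eq_of_apply_eq hw.bijective hφ, linInv_eq_of_apply_eq hp.bijective hψ, ← hφ, ← hψ]
  by_cases h1 : φ = 0
  · have h2 : ψ ≠ 0 := fun h2 => hx (Prod.ext (by rw [← hφ, h1]; simp) (by rw [← hψ, h2]; simp))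
    exact add_pos_of_nonneg_of_pos (hw.nonneg φ) (hp.2 ψ h2)
  · exact add_pos_of_pos_of_nonneg (hw.2 φ h1) (hp.nonneg ψ)

theorem fov_equivalent {c₁ c₂ c₁w c₂w c₁p c₂p ρ : ℝ} (hc₁ : 0 < c₁) (hc₂ : 0 < c₂)
    (hDA : ∀ w : D.W, c₁ ^ 2 * D.DA w w ≤ D.A w w) (hAD : ∀ w : D.W, D.A w w ≤ c₂ ^ 2 * D.DA w w)
    (hc₁w : 0 < c₁w) (hc₂w : 0 < c₂w) (hc₁p : 0 < c₁p) (hc₂p : 0 < c₂p) (hρ₀ : 0 ≤ ρ) (hρ : ρ < 1)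
    (hHw : IsSPD Hw) (hHp : IsSPD Hp)
    (hw : SpectrallyEquiv c₁w c₂w Hw (linInv D.A))
    (hp : SpectrallyEquiv c₁p c₂p Hp (linInv D.Schur))
    (hI : ∀ w : D.W, D.normA (w - Hw (D.A w)) ≤ ρ * D.normA w) {x : D.X} (hx : x ≠ 0) :
    (1 - ρ) / 2 * min c₂w⁻¹ (c₂w⁻¹ * (c₂ ^ 2)⁻¹ * c₂p⁻¹) ≤
      D.ip (D.MD Hw Hp) (D.ML Hw Hp (D.calA x)) x / D.ip (D.MD Hw Hp) x x ∧
    D.ipNorm (D.MD Hw Hp) (D.ML Hw Hp (D.calA x)) / D.ipNorm (D.MD Hw Hp) x ≤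
      max (2 * c₁w⁻¹) (c₁p⁻¹ * (c₁ ^ 2)⁻¹ * (1 + c₁w⁻¹)) := by
  have hAb := hw.bijective hc₁w hHw
  have hApos : ∀ w, w ≠ 0 → 0 < D.A w w := fun w h =>
    form_pos_of_bijective D.aForm_comm D.aForm_self_nonneg hAb.1 h
  -- Definiteness passes from `A` to `D_A` through the upper bound of the norm equivalence.
  have hDpos : ∀ w, w ≠ 0 → 0 < D.DA w w := fun w h =>
    pos_of_mul_pos_right ((hApos w h).trans_le (hAD w)) (sq_nonneg _)
  have hwb := hHw.bijective
  have hpb := hHp.bijective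
  have hpos := D.ip_MD_pos hHw hHp hx
  have hnorm : 0 < D.ipNorm (D.MD Hw Hp) x := Real.sqrt_pos.2 hpos
  obtain ⟨h1, h2⟩ := fov_bounds (B := D.B) hc₁ hc₂ hc₁w hc₂w hc₁p hc₂p hρ₀ hρ D.aForm_comm hApos
    D.aDForm_comm hDpos hDA hAD hHw hHp hw hp hI (apply_linInv_apply hwb x.1)
    (apply_linInv_apply hpb x.2) rfl rfl rfl rfl
  have hip : ∀ y, D.ip (D.MD Hw Hp) (D.ML Hw Hp (D.calA x)) y =
      (D.A x.1 + D.B.flip x.2) y.1 + D.B (Hw (D.A x.1 + D.B.flip x.2) - x.1) y.2 := by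
    intro y
    rw [D.ip_MD hwb hpb, D.ML_calA hwb hpb, linInv_apply_apply hwb, linInv_apply_apply hpb]
    rfl
  constructor
  · rw [le_div_iff₀ hpos, hip, D.ip_MD hwb hpb]
    exact h1
  · rw [div_le_iff₀ hnorm, ipNorm, ipNorm]
    have hξ : 0 ≤ max (2 * c₁w⁻¹) (c₁p⁻¹ * (c₁ ^ 2)⁻¹ * (1 + c₁w⁻¹)) :=
      le_max_of_le_left (by positivity)
    refine (Real.sqrt_le_left (mul_nonneg hξ (Real.sqrt_nonneg _))).2 ?_
    rw [mul_pow, Real.sq_sqrt hpos.le, hip, D.ip_MD hwb hpb, D.ML_calA hwb hpb]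
    exact h2

end Problem

end MixedDim

theorem mainTheorem7 (n : ℕ) (hn : n = 2 ∨ n = 3) (σ : ℝ) :
    ∃ c₂ > 0, ∀ κ : ℝ, ∃ c₁ > 0, ∀ D : MixedDim.Problem n,
      (∀ e, MixedDim.ShapeRegular σ (D.𝓣.T e)) → D.P.AnisotropyLE κ →
      (∀ r : D.W, c₁ * D.normDA r ≤ D.normA r ∧ D.normA r ≤ c₂ * D.normDA r) ∧
      ∀ (c₁w c₂w c₁p c₂p ρ : ℝ) (Hw : D.W' →ₗ[ℝ] D.W) (Hp : D.Q' →ₗ[ℝ] D.Q),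
        0 < c₁w → 0 < c₂w → 0 < c₁p → 0 < c₂p → 0 ≤ ρ → ρ < 1 →
        MixedDim.IsSPD Hw → MixedDim.IsSPD Hp →
        MixedDim.SpectrallyEquiv c₁w c₂w Hw (MixedDim.linInv D.A) →
        MixedDim.SpectrallyEquiv c₁p c₂p Hp (MixedDim.linInv D.Schur) →
        (∀ w : D.W, D.normA (w - Hw (D.A w)) ≤ ρ * D.normA w) →
        ∃ ξ₁ > 0, ∃ ξ₂ > 0,
          ξ₁ = (1 - ρ) / 2 * min c₂w⁻¹ (c₂w⁻¹ * (c₂ ^ 2)⁻¹ * c₂p⁻¹) ∧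
          ξ₂ = max (2 * c₁w⁻¹) (c₁p⁻¹ * (c₁ ^ 2)⁻¹ * (1 + c₁w⁻¹)) ∧
          ∀ x : D.X, x ≠ 0 →
            ξ₁ ≤ D.ip (D.MD Hw Hp) (D.ML Hw Hp (D.calA x)) x / D.ip (D.MD Hw Hp) x x ∧
            D.ipNorm (D.MD Hw Hp) (D.ML Hw Hp (D.calA x)) / D.ipNorm (D.MD Hw Hp) x ≤ ξ₂ := by
  have hn0 : (0 : ℝ) < n + 1 := by positivity
  -- Both constants are square roots because the form estimates bound squared norms; `c₂` comes from
  -- the number of faces alone and is chosen before `κ`.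
  refine ⟨√(n + 1), Real.sqrt_pos.2 hn0, fun κ => ?_⟩
  set C : ℝ := max 1 ((n + 1) * 4 ^ (n + 1) * σ ^ 2 * κ) with hC
  have hC0 : 0 < C := zero_lt_one.trans_le (le_max_left _ _)
  refine ⟨√C⁻¹, Real.sqrt_pos.2 (inv_pos.2 hC0), fun D hσ hκ => ?_⟩
  have hc₁ : 0 < √C⁻¹ := Real.sqrt_pos.2 (inv_pos.2 hC0)
  have hc₂ : 0 < √((n : ℝ) + 1) := Real.sqrt_pos.2 hn0
  have hDA : ∀ w : D.W, √C⁻¹ ^ 2 * D.DA w w ≤ D.A w w := fun w => by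
    rw [Real.sq_sqrt (inv_pos.2 hC0).le, inv_mul_le_iff₀ hC0]
    exact D.aDForm_le hσ hκ w
  have hAD : ∀ w : D.W, D.A w w ≤ √((n : ℝ) + 1) ^ 2 * D.DA w w := fun w => by
    rw [Real.sq_sqrt hn0.le]
    exact D.aForm_le w
  have hD0 : ∀ w : D.W, 0 ≤ D.DA w w := D.aDForm_self_nonneg
  refine ⟨fun r => ⟨?_, ?_⟩, ?_⟩
  · rw [MixedDim.Problem.normDA, MixedDim.Problem.normA]
    refine Real.le_sqrt_of_sq_le ?_
    rw [mul_pow, Real.sq_sqrt (hD0 r)]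
    exact hDA r
  · rw [MixedDim.Problem.normDA, MixedDim.Problem.normA]
    refine (Real.sqrt_le_left (mul_nonneg hc₂.le (Real.sqrt_nonneg _))).2 ?_
    rw [mul_pow, Real.sq_sqrt (hD0 r)]
    exact hAD r
  · intro c₁w c₂w c₁p c₂p ρ Hw Hp hc₁w hc₂w hc₁p hc₂p hρ₀ hρ hHw hHp hw hp hI
    have h1ρ : 0 < 1 - ρ := sub_pos.2 hρ
    refine ⟨_, ?_, _, ?_, rfl, rfl, fun x hx => D.fov_equivalent hc₁ hc₂ hDA hAD hc₁w hc₂w hc₁p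
      hc₂p hρ₀ hρ hHw hHp hw hp hI hx⟩
    · have : 0 < min c₂w⁻¹ (c₂w⁻¹ * (√((n : ℝ) + 1) ^ 2)⁻¹ * c₂p⁻¹) :=
        lt_min (by positivity) (by positivity)
      positivity
    · exact lt_max_of_lt_left (by positivity)
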